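/- Let $X$ be a countably infinite discrete set, $m:X\to(0,\infty)$ and $1<p<\infty$. A connected graph over $(X,m)$ is a symmetric map $b:X\times X\to[0,\infty)$ with zero diagonal and $\sum_{y}b(x,y)<\infty$ for all $x$, such that any two vertices are joined by a finite path along pairs with $b>0$ (local finiteness is not assumed). Write $\nabla_{xy}f=f(x)-f(y)$, $a^{\langle r\rangle}=a|a|^{r-1}$ for $a\ne0$ and $0^{\langle r\rangle}=0$, $f_+=\max\{f,0\}$, and let $\mathcal F_b(X)$ be the set of $f:X\to\mathbb R$ with $\sum_y b(x,y)|\nabla_{xy}f|^{p-1}<\infty$ for all $x$. For $V:X\to\mathbb R$ and $f\in\mathcal F_b(X)$ put $$\Delta_pf(x)=\frac1{m(x)}\sum_{y}b(x,y)(\nabla_{xy}f)^{\langle p-1\rangle},\qquad \mathcal H[f]=\Delta_pf+V f^{\langle p-1\rangle},$$ and for finitely supported $\varphi$ put $\mathcal Q_V(\varphi)=\frac12\sum_{x,y}b(x,y)|\nabla_{xy}\varphi|^p+\sum_x m(x)V(x)|\varphi(x)|^p$. A function $f\in\mathcal F_b(X)$ is $\mathcal H$-superharmonic (subharmonic) if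 $\mathcal H[f]\ge0$ ($\le0$) on $X$. "Positive" means $\geq 0$ and not identically $0$. The operator $\mathcal H$ is positive if it admits a positive $\mathcal H$-superharmonic function. It is critical if $\mathcal Q_V\ge0$ on finitely supported functions and there is no positive $W:X\to\mathbb R$ with $\mathcal Q_{V-W}\ge0$ on finitely supported functions; a strictly positive $\mathcal H$-superharmonic function of a critical $\mathcal H$ is called an Agmon ground state of $\mathcal H$. A positive $p$-harmonic function of minimal growth at infinity is a function $g\in\mathcal F_b(X)$, $g>0$, for which there is a finite $K_0\subset X$ with $\Delta_pg=0$ on $X\setminus K_0$ such that for every finite $K\supseteq K_0$ and every strictly positive $w\in\mathcal F_b(X)$ with $\Delta_pw\ge0$ on $X\setminus K$ and $g\le w$ on $K$ one has $g\le w$ on $X\setminus K$. **Corollary.** Let $\mathcal H=\Delta_p+V$ be a positive quasilinear Schrödinger operator associated to a connected graph $b$ over $(X,m)$ with potential $V\le0$. Let $\tilde{\mathcal H}$ be a critical quasilinear Schrödinger operator (with the same $p$ and an arbitrary real potential) associated to a connected graph $\tilde b$ over $(X,m)$, with Agmon ground state $v>0$. Let $u$ be an $\mathcal H$-subharmonic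 function with non-trivial positive part $u_+$ such that for some $C>0$ and all $x,y$ with $u(x)>0$, $u(y)>0$, $$b(x,y)^{2/p}\,u_+(x)u_+(y)\le C\,\tilde b(x,y)^{2/p}\,v(x)v(y),$$ and, if moreover $b(x,y)>0$, $$b(x,y)^{1-2/p}\,|\nabla_{xy}u_+|^{p-2}\le C\,\tilde b(x,y)^{1-2/p}\,|\nabla_{xy}v|^{p-2},$$ where both sides are read in $[0,\infty]$, with $0^{r}=\infty$ for $r<0$ and $0^0=1$. Suppose further that for some positive $p$-harmonic function $g$ of minimal growth at infinity (with respect to $b$ and $m$) $$\liminf_{x\to\infty}\frac{u_+(x)}{g(x)}=0,$$ where $x\to\infty$ means that $x$ leaves every finite set. Then $u=0$. (In other words, there is no such $u$ with $u_+\neq 0$: every $\mathcal H$-subharmonic function satisfying the other conditions has $u_+=0$.) -/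

import Mathlib

open Filter
open scoped ENNReal

noncomputable section

namespace QuasiLandis

/-- A connected weighted graph `b` over the discrete set `X`. It need not be locally finite. -/
structure IsConnectedGraph {X : Type*} (b : X → X → ℝ) : Prop where
  nonneg : ∀ x y, 0 ≤ b x y
  symm : ∀ x y, b x y = b y x
  diag : ∀ x, b x x = 0
  summable : ∀ x, Summable fun y => b x y
  connected : ∀ x y, Relation.ReflTransGen (fun z w => 0 < b z w) x y

/-- The signed power `a^⟨r⟩ = a |a|^(r-1)` for `a ≠ 0`, and `0^⟨r⟩ = 0`. -/
def signedPow (a r : ℝ) : ℝ := a * |a| ^ (r - 1)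

/-- The space `F_b(X)` on which the `p`-Laplacian acts. -/
def formalDomain {X : Type*} (p : ℝ) (b : X → X → ℝ) : Set (X → ℝ) :=
  {f | ∀ x, Summable fun y => b x y * |f x - f y| ^ (p - 1)}

/-- The weighted `p`-Laplacian `Δ_p`. -/
def pLaplacian {X : Type*} (p : ℝ) (b : X → X → ℝ) (m : X → ℝ) (f : X → ℝ) (x : X) : ℝ :=
  (1 / m x) * ∑' y, b x y * signedPow (f x - f y) (p - 1)

/-- The quasilinear Schrödinger operator `H = Δ_p + V`. -/
def schrodinger {X : Type*} (p : ℝ) (b : X → X → ℝ) (m V : X → ℝ) (f : X → ℝ) (x : X) : ℝ :=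
  pLaplacian p b m f x + V x * signedPow (f x) (p - 1)

/-- The energy functional `Q_{p,b,m,V}`, used only for finitely supported `φ`. -/
def energy {X : Type*} (p : ℝ) (b : X → X → ℝ) (m V : X → ℝ) (φ : X → ℝ) : ℝ :=
  (1 / 2) * (∑' q : X × X, b q.1 q.2 * |φ q.1 - φ q.2| ^ p) + ∑' x, m x * V x * |φ x| ^ p

/-- `Q ≥ 0` on `C_c(X)`. -/
def EnergyNonneg {X : Type*} (p : ℝ) (b : X → X → ℝ) (m V : X → ℝ) : Prop :=
  ∀ φ : X → ℝ, φ.support.Finite → 0 ≤ energy p b m V φ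

def IsSuperharmonic {X : Type*} (p : ℝ) (b : X → X → ℝ) (m V : X → ℝ) (f : X → ℝ) : Prop :=
  f ∈ formalDomain p b ∧ ∀ x, 0 ≤ schrodinger p b m V f x

def IsSubharmonic {X : Type*} (p : ℝ) (b : X → X → ℝ) (m V : X → ℝ) (f : X → ℝ) : Prop :=
  f ∈ formalDomain p b ∧ ∀ x, schrodinger p b m V f x ≤ 0

/-- `H ≥ 0`: there is a positive (nonnegative, not identically zero) `H`-superharmonic function. -/
def IsPositiveOperator {X : Type*} (p : ℝ) (b : X → X → ℝ) (m V : X → ℝ) : Prop :=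
  ∃ s : X → ℝ, 0 ≤ s ∧ s ≠ 0 ∧ IsSuperharmonic p b m V s

/-- The energy functional is nonnegative and critical: no positive (nonnegative, not identically
zero) function `W` can be subtracted from the potential without losing nonnegativity. -/
def IsCritical {X : Type*} (p : ℝ) (b : X → X → ℝ) (m V : X → ℝ) : Prop :=
  EnergyNonneg p b m V ∧
    ¬ ∃ W : X → ℝ, 0 ≤ W ∧ W ≠ 0 ∧ EnergyNonneg p b m (V - W)

/-- `v` is an Agmon ground state of `H`: `H` is critical and `v` is a strictly positive
`H`-superharmonic function. (For critical `H` such a function is automatically `H`-harmonic and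
unique up to a positive multiple; neither is required here.) -/
def IsAgmonGroundState {X : Type*} (p : ℝ) (b : X → X → ℝ) (m V : X → ℝ) (v : X → ℝ) : Prop :=
  IsCritical p b m V ∧ (∀ x, 0 < v x) ∧ IsSuperharmonic p b m V v

/-- `g` is a positive solution of `H[g] = 0` of minimal growth at infinity in `X`. -/
def IsMinimalGrowth {X : Type*} (p : ℝ) (b : X → X → ℝ) (m V : X → ℝ) (g : X → ℝ) : Prop :=
  g ∈ formalDomain p b ∧ (∀ x, 0 < g x) ∧
    ∃ K₀ : Finset X, (∀ x, x ∉ K₀ → schrodinger p b m V g x = 0) ∧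
      ∀ K : Finset X, K₀ ⊆ K → ∀ w : X → ℝ, w ∈ formalDomain p b → (∀ x, 0 < w x) →
        (∀ x, x ∉ K → 0 ≤ schrodinger p b m V w x) →
        (∀ x ∈ K, g x ≤ w x) → ∀ x, x ∉ K → g x ≤ w x

/-- The quantity `b(x,y)^(1-2/p) |f(x) - f(y)|^(p-2)` as an element of `[0,∞]`; for `p < 2` the
negative powers of zero are `∞`. -/
def gradientWeight {X : Type*} (p : ℝ) (b : X → X → ℝ) (f : X → ℝ) (x y : X) : ℝ≥0∞ :=
  ENNReal.ofReal (b x y) ^ (1 - 2 / p) * ENNReal.ofReal |f x - f y| ^ (p - 2)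

end QuasiLandis

end

noncomputable section

namespace QuasiLandis

/-! ### The signed power -/

/-! The hypotheses are contradictory. Let `s` be a positive superharmonic function; connectedness
makes it strictly positive. The core is a Liouville comparison principle giving `u⁺ = c * s` with `c
> 0` (`exists_eq_const_mul`). Since `V ≤ 0`, `s` is also `p`-superharmonic, so minimal growth yields
`g ≤ K * s` (`IsMinimalGrowth.exists_le_const_mul`). Hence `u⁺ / g ≥ c / K` everywhere, and the
liminf cannot vanish.

The comparison principle rests on the ground state representation `energy_mul_eq`: the energy of `w
* ψ` is half the edge sum of the nonnegative `piconeGap` plus a term carrying the sign of `H[w]`.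
Criticality supplies `ψ n` with `ψ n o = 1` and the energy of `v * ψ n` tending to 0; vanishing gaps
of `v` force `ψ n → 1` pointwise. The two hypotheses linking `u` and `v` bound the gaps of `u⁺` by
those of `v` (`exists_piconeGap_comparison`), so the energy of `u⁺ * ψ n` is bounded above by a null
sequence. Written as the energy of `s * (u⁺ * ψ n / s)`, it controls the gaps of `s`; in the limit
`u⁺ / s` is constant along edges.

The analytic input is that `piconeGap` is comparable to `simplifiedDensity`
(`exists_piconeGap_bounds`). It follows from two-sided Jensen bounds for `|·| ^ p`, because the gap
is a rescaled Jensen gap. -/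

theorem signedPow_zero (r : ℝ) : signedPow 0 r = 0 := by simp [signedPow]

theorem signedPow_neg (a r : ℝ) : signedPow (-a) r = -signedPow a r := by simp [signedPow]

theorem abs_signedPow (a : ℝ) {r : ℝ} (hr : 0 < r) : |signedPow a r| = |a| ^ r := by
  rcases eq_or_ne a 0 with rfl | ha
  · simp [signedPow, Real.zero_rpow hr.ne']
  · rw [signedPow, abs_mul, abs_of_nonneg (Real.rpow_nonneg (abs_nonneg a) _),
      ← Real.rpow_one_add' (abs_nonneg a) (by linarith)]
    congr 1; ring

theorem signedPow_of_nonneg {a r : ℝ} (ha : 0 ≤ a) (hr : 0 < r) : signedPow a r = a ^ r := by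
  have h := abs_signedPow a hr
  rw [signedPow] at h ⊢
  rw [abs_of_nonneg ha] at h ⊢
  rwa [abs_of_nonneg (mul_nonneg ha (Real.rpow_nonneg ha _))] at h

theorem mul_signedPow (a : ℝ) {p : ℝ} (hp : 1 < p) : a * signedPow a (p - 1) = |a| ^ p := by
  rcases eq_or_ne a 0 with rfl | ha
  · simp [Real.zero_rpow (by linarith : p ≠ 0)]
  · have h0 : 0 < |a| := abs_pos.2 ha
    rw [signedPow, ← mul_assoc, ← sq, ← sq_abs, ← Real.rpow_natCast, ← Real.rpow_add h0]
    congr 1; push_cast; ring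

theorem signedPow_mul {t : ℝ} (ht : 0 < t) (a r : ℝ) :
    signedPow (t * a) r = t ^ r * signedPow a r := by
  rw [signedPow, signedPow, abs_mul, abs_of_pos ht, Real.mul_rpow ht.le (abs_nonneg a),
    Real.rpow_sub_one ht.ne']
  field_simp

/-! ### Powers of comparable numbers -/

/-- The sign of `r` decides which of the two inequalities is used; if one of the numbers vanishes,
so does the other. -/
theorem rpow_le_of_comparable {K x y : ℝ} (hK : 1 ≤ K) (hx : 0 ≤ x) (hy : 0 ≤ y)
    (hxy : x ≤ K * y) (hyx : y ≤ K * x) (r : ℝ) : x ^ r ≤ K ^ |r| * y ^ r := by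
  have hK0 : 0 < K := by linarith
  rcases hx.eq_or_lt with rfl | hx
  · obtain rfl : y = 0 := by linarith
    exact le_mul_of_one_le_left (Real.rpow_nonneg le_rfl r)
      (Real.one_le_rpow hK (abs_nonneg r))
  rcases hy.eq_or_lt with rfl | hy
  · linarith
  rcases le_total 0 r with hr | hr
  · rw [abs_of_nonneg hr, ← Real.mul_rpow hK0.le hy.le]
    exact Real.rpow_le_rpow hx.le hxy hr
  · rw [abs_of_nonpos hr, Real.rpow_neg hK0.le, ← Real.inv_rpow hK0.le,
      ← Real.mul_rpow (by positivity) hy.le]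
    refine Real.rpow_le_rpow_of_nonpos (by positivity) ?_ hr
    rw [inv_mul_le_iff₀ hK0]
    exact hyx

/-- Away from zero the product is `x ^ 2 / (x + y)` times `(x + y) ^ (r + 1)`, and both factors
increase with `x`. -/
theorem sq_mul_rpow_mono {x X y r : ℝ} (hx : 0 ≤ x) (hX : x ≤ X) (hy : 0 ≤ y) (hr : -1 ≤ r) :
    x ^ 2 * (x + y) ^ r ≤ X ^ 2 * (X + y) ^ r := by
  rcases hx.eq_or_lt with rfl | hx
  · simp only [ne_eq, OfNat.ofNat_ne_zero, not_false_eq_true, zero_pow, zero_mul]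
    positivity
  have hX0 : 0 < X := hx.trans_le hX
  have key : ∀ t : ℝ, 0 < t → t ^ r = t⁻¹ * t ^ (r + 1) := fun t ht => by
    rw [← Real.rpow_neg_one, ← Real.rpow_add ht]; congr 1; ring
  rw [key _ (by positivity), key _ (by positivity), ← mul_assoc, ← mul_assoc]
  refine mul_le_mul ?_ (Real.rpow_le_rpow (by positivity) (by linarith) (by linarith))
    (by positivity) (by positivity)
  rw [← div_eq_mul_inv, ← div_eq_mul_inv, div_le_div_iff₀ (by positivity) (by positivity)]
  nlinarith [mul_nonneg (mul_nonneg hx.le hX0.le) (sub_nonneg.2 hX),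
    mul_nonneg hy (mul_nonneg (add_pos hx hX0).le (sub_nonneg.2 hX))]

/-! ### Monotonicity of the signed power -/

/-- For `q ≥ 0` this is Bernoulli's inequality; for `q ≤ 0` both differences lie in `[1, 2]`. -/
theorem one_sub_signedPow_bounds {r q : ℝ} (hr : 0 < r) (hq : |q| ≤ 1) :
    min (1 / 2) r * (1 - q) ≤ 1 - signedPow q r ∧ 1 - signedPow q r ≤ max 2 r * (1 - q) := by
  obtain ⟨h1, h2⟩ := abs_le.1 hq
  have hmin : 0 ≤ 1 - q := by linarith
  rcases le_total 0 q with h0 | h0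
  · rw [signedPow_of_nonneg h0 hr]
    rcases le_total 1 r with h | h
    · have e1 := one_add_mul_self_le_rpow_one_add (s := q - 1) (by linarith) h
      have e2 : q ^ r ≤ q := by
        simpa using Real.rpow_le_rpow_of_exponent_ge' h0 h2 zero_le_one h
      rw [add_sub_cancel] at e1
      constructor
      · nlinarith [min_le_left (1 / 2) r]
      · nlinarith [le_max_right 2 r]
    · have e1 := rpow_one_add_le_one_add_mul_self (s := q - 1) (by linarith) hr.le h
      have e2 : q ≤ q ^ r := by
        simpa using Real.rpow_le_rpow_of_exponent_ge' h0 h2 hr.le h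
      rw [add_sub_cancel] at e1
      constructor
      · nlinarith [min_le_right (1 / 2) r]
      · nlinarith [le_max_left 2 r]
  · have e1 : 0 ≤ (-q) ^ r := Real.rpow_nonneg (by linarith) r
    have e2 : (-q) ^ r ≤ 1 := Real.rpow_le_one (by linarith) (by linarith) hr.le
    have e3 : signedPow q r = -(-q) ^ r := by
      rw [← signedPow_of_nonneg (by linarith : 0 ≤ -q) hr, signedPow_neg, neg_neg]
    rw [e3]
    constructor
    · nlinarith [min_le_left (1 / 2) r]
    · nlinarith [le_max_left 2 r]

/-- Swapping the arguments, changing both signs and homogeneity reduce the claim to the pair `1, q`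
with `|q| ≤ 1`, where `(1 + |q|) ^ (r - 1)` is comparable to 1. -/
theorem exists_signedPow_monotone_bounds {r : ℝ} (hr : 0 < r) :
    ∃ c > 0, ∃ C > 0, ∀ z w : ℝ,
      c * ((z - w) ^ 2 * (|z| + |w|) ^ (r - 1)) ≤ (z - w) * (signedPow z r - signedPow w r) ∧
      (z - w) * (signedPow z r - signedPow w r) ≤ C * ((z - w) ^ 2 * (|z| + |w|) ^ (r - 1)) := by
  set k : ℝ := 2 ^ |r - 1| with hk
  have hk0 : 0 < k := by positivity
  have hc : 0 < min (1 / 2) r := lt_min (by norm_num) hr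
  have hC : 0 < max 2 r := lt_max_of_lt_left (by norm_num)
  refine ⟨min (1 / 2) r / k, div_pos hc hk0, max 2 r * k, mul_pos hC hk0, ?_⟩
  set P : ℝ → ℝ → Prop := fun z w =>
    min (1 / 2) r / k * ((z - w) ^ 2 * (|z| + |w|) ^ (r - 1)) ≤
        (z - w) * (signedPow z r - signedPow w r) ∧
      (z - w) * (signedPow z r - signedPow w r) ≤
        max 2 r * k * ((z - w) ^ 2 * (|z| + |w|) ^ (r - 1)) with hP
  change ∀ z w, P z w
  have hneg : ∀ z w, P (-z) (-w) → P z w := by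
    intro z w h
    simp only [hP, signedPow_neg, abs_neg] at h ⊢
    ring_nf at h ⊢
    exact h
  have hswap : ∀ z w, P w z → P z w := by
    intro z w h
    simp only [hP] at h ⊢
    rw [add_comm |w|] at h
    ring_nf at h ⊢
    exact h
  have hone : ∀ z w, 0 ≤ z → |w| ≤ z → P z w := by
    intro z w hz hw
    rcases hz.eq_or_lt with rfl | hz
    · obtain rfl : w = 0 := abs_nonpos_iff.1 hw
      simp [hP]
    obtain ⟨q, rfl⟩ : ∃ q, w = z * q := ⟨w / z, by field_simp⟩
    have hq : |q| ≤ 1 := by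
      rw [abs_mul, abs_of_pos hz] at hw
      nlinarith
    have hz2 : signedPow z r = z ^ r := signedPow_of_nonneg hz.le hr
    obtain ⟨b1, b2⟩ := one_sub_signedPow_bounds hr hq
    have hq0 : 0 ≤ 1 - q := by linarith [(abs_le.1 hq).2]
    have k1 : (1 + |q|) ^ (r - 1) ≤ k := by
      have := rpow_le_of_comparable (K := 2) (x := 1 + |q|) (y := 1) (by norm_num) (by positivity)
        (by norm_num) (by linarith) (by linarith [abs_nonneg q]) (r - 1)
      simpa using this
    have k2 : 1 ≤ k * (1 + |q|) ^ (r - 1) := by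
      have := rpow_le_of_comparable (K := 2) (x := 1) (y := 1 + |q|) (by norm_num) (by positivity)
        (by positivity) (by linarith [abs_nonneg q]) (by linarith) (r - 1)
      simpa using this
    have e1 : |z| + |z * q| = z * (1 + |q|) := by
      rw [abs_mul, abs_of_pos hz]; ring
    have e2 : z ^ 2 * z ^ (r - 1) = z * z ^ r := by
      rw [Real.rpow_sub_one hz.ne']; field_simp
    simp only [hP]
    rw [e1, Real.mul_rpow hz.le (by positivity), signedPow_mul hz, hz2,
      show (z - z * q) ^ 2 * (z ^ (r - 1) * (1 + |q|) ^ (r - 1)) =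
        z ^ 2 * z ^ (r - 1) * ((1 - q) ^ 2 * (1 + |q|) ^ (r - 1)) by ring, e2,
      show (z - z * q) * (z ^ r - z ^ r * signedPow q r) =
        z * z ^ r * ((1 - q) * (1 - signedPow q r)) by ring,
      mul_left_comm, mul_left_comm _ (z * z ^ r)]
    have hzz : 0 ≤ z * z ^ r := by positivity
    constructor
    · refine mul_le_mul_of_nonneg_left ?_ hzz
      rw [div_mul_eq_mul_div, div_le_iff₀ hk0]
      calc min (1 / 2) r * ((1 - q) ^ 2 * (1 + |q|) ^ (r - 1))
          = (1 - q) * (min (1 / 2) r * (1 - q)) * (1 + |q|) ^ (r - 1) := by ring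
        _ ≤ (1 - q) * (1 - signedPow q r) * k := by
          refine mul_le_mul (mul_le_mul_of_nonneg_left b1 hq0) k1 (by positivity)
            (mul_nonneg hq0 ((mul_nonneg hc.le hq0).trans b1))
    · refine mul_le_mul_of_nonneg_left ?_ hzz
      calc (1 - q) * (1 - signedPow q r) ≤ (1 - q) * (max 2 r * (1 - q)) * 1 := by
            rw [mul_one]; exact mul_le_mul_of_nonneg_left b2 hq0
        _ ≤ (1 - q) * (max 2 r * (1 - q)) * (k * (1 + |q|) ^ (r - 1)) :=
            mul_le_mul_of_nonneg_left k2 (mul_nonneg hq0 (mul_nonneg hC.le hq0))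
        _ = _ := by ring
  have htwo : ∀ z w, |w| ≤ |z| → P z w := by
    intro z w h
    rcases le_total 0 z with hz | hz
    · exact hone z w hz (by rwa [abs_of_nonneg hz] at h)
    · exact hneg z w (hone _ _ (by linarith) (by rwa [abs_of_nonpos hz, ← abs_neg w] at h))
  intro z w
  rcases le_total |w| |z| with h | h
  · exact htwo z w h
  · exact hswap z w (htwo w z h)

theorem signedPow_mono {r : ℝ} (hr : 0 < r) : Monotone fun a => signedPow a r := by
  intro z w h
  obtain ⟨c, hc, _, _, H⟩ := exists_signedPow_monotone_bounds hr
  rcases h.eq_or_lt with rfl | h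
  · exact le_rfl
  have h1 := (H z w).1
  have h2 : 0 ≤ c * ((z - w) ^ 2 * (|z| + |w|) ^ (r - 1)) := by positivity
  change signedPow z r ≤ signedPow w r
  by_contra! h3
  nlinarith

/-! ### Jensen gap of `|·| ^ p` -/

/-- The graph of `|·| ^ p` lies above its tangent at `z`, by Young's inequality with exponents `p`
and `p / (p - 1)`. -/
theorem abs_rpow_tangent {p : ℝ} (hp : 1 < p) (z w : ℝ) :
    |z| ^ p - |w| ^ p ≤ p * signedPow z (p - 1) * (z - w) := by
  have hq := Real.HolderConjugate.conjExponent hp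
  have h := Real.young_inequality_of_nonneg (abs_nonneg w)
    (Real.rpow_nonneg (abs_nonneg z) (p - 1)) hq
  rw [← Real.rpow_mul (abs_nonneg z), Real.conjExponent,
    mul_div_cancel₀ p (by linarith : p - 1 ≠ 0)] at h
  have h1 : signedPow z (p - 1) * w ≤ |w| * |z| ^ (p - 1) := by
    rw [← abs_signedPow z (by linarith : 0 < p - 1), mul_comm, ← abs_mul]
    exact le_abs_self _
  have h2 := mul_signedPow z hp
  have h3 : p * (|w| ^ p / p + |z| ^ p / (p / (p - 1))) = |w| ^ p + (p - 1) * |z| ^ p := by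
    have : p ≠ 0 := by linarith
    have : p - 1 ≠ 0 := by linarith
    field_simp
  have h4 : p * (signedPow z (p - 1) * w) ≤ |w| ^ p + (p - 1) * |z| ^ p := by
    rw [← h3]; exact mul_le_mul_of_nonneg_left (h1.trans h) (by linarith)
  have h5 : p * signedPow z (p - 1) * (z - w) =
      p * (z * signedPow z (p - 1)) - p * (signedPow z (p - 1) * w) := by ring
  rw [h5, h2]
  linarith

theorem abs_rpow_convex {p : ℝ} (hp : 1 < p) {l : ℝ} (h0 : 0 ≤ l) (h1 : l ≤ 1) (z w : ℝ) :
    |l * z + (1 - l) * w| ^ p ≤ l * |z| ^ p + (1 - l) * |w| ^ p := by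
  have e1 := mul_le_mul_of_nonneg_left (abs_rpow_tangent hp (l * z + (1 - l) * w) z) h0
  have e2 := mul_le_mul_of_nonneg_left (abs_rpow_tangent hp (l * z + (1 - l) * w) w)
    (sub_nonneg.2 h1)
  nlinarith

/-- Go from each end to the midpoint in two steps, using the tangents at the quarter point and at
the midpoint. The midpoint slopes cancel, leaving the slopes at the quarter points. -/
theorem midpoint_gap_ge {p : ℝ} (hp : 1 < p) (z w : ℝ) :
    p / 4 * ((z - w) * (signedPow ((3 * z + w) / 4) (p - 1) -
        signedPow ((z + 3 * w) / 4) (p - 1))) ≤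
      |z| ^ p + |w| ^ p - 2 * |(z + w) / 2| ^ p := by
  have e1 := abs_rpow_tangent hp ((3 * z + w) / 4) z
  have e2 := abs_rpow_tangent hp ((z + w) / 2) ((3 * z + w) / 4)
  have e3 := abs_rpow_tangent hp ((z + 3 * w) / 4) w
  have e4 := abs_rpow_tangent hp ((z + w) / 2) ((z + 3 * w) / 4)
  nlinarith

/-- For `l ≤ 1 / 2` the mixture lies between the midpoint and `w`, so convexity on that half
suffices. -/
theorem jensen_gap_ge_midpoint {p : ℝ} (hp : 1 < p) {l : ℝ} (h0 : 0 ≤ l) (h1 : l ≤ 1 / 2)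
    (z w : ℝ) :
    l * (|z| ^ p + |w| ^ p - 2 * |(z + w) / 2| ^ p) ≤
      l * |z| ^ p + (1 - l) * |w| ^ p - |l * z + (1 - l) * w| ^ p := by
  have h := abs_rpow_convex hp (l := 2 * l) (by linarith) (by linarith) ((z + w) / 2) w
  rw [show 2 * l * ((z + w) / 2) + (1 - 2 * l) * w = l * z + (1 - l) * w by ring] at h
  linarith

theorem exists_jensen_gap_bounds {p : ℝ} (hp : 1 < p) :
    ∃ c > 0, ∃ C > 0, ∀ l z w : ℝ, 0 ≤ l → l ≤ 1 →
      c * (l * (1 - l) * ((z - w) ^ 2 * (|z| + |w|) ^ (p - 2))) ≤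
        l * |z| ^ p + (1 - l) * |w| ^ p - |l * z + (1 - l) * w| ^ p ∧
      l * |z| ^ p + (1 - l) * |w| ^ p - |l * z + (1 - l) * w| ^ p ≤
        C * (l * (1 - l) * ((z - w) ^ 2 * (|z| + |w|) ^ (p - 2))) := by
  obtain ⟨c, hc, C, hC, H⟩ := exists_signedPow_monotone_bounds (by linarith : 0 < p - 1)
  simp only [show p - 1 - 1 = p - 2 by ring] at H
  set k : ℝ := 4 ^ |p - 2| with hk
  have hk0 : 0 < k := by positivity
  have hp0 : 0 < p := by linarith
  set E : ℝ → ℝ → ℝ := fun z w => (z - w) ^ 2 * (|z| + |w|) ^ (p - 2) with hE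
  have hE0 : ∀ z w, 0 ≤ E z w := fun z w => by positivity
  have hmid : ∀ z w, p / 8 * (c / k) * E z w ≤ |z| ^ p + |w| ^ p - 2 * |(z + w) / 2| ^ p := by
    intro z w
    refine le_trans ?_ (midpoint_gap_ge hp z w)
    have h := (H ((3 * z + w) / 4) ((z + 3 * w) / 4)).1
    have hcomp : (|z| + |w|) ^ (p - 2) ≤
        k * (|(3 * z + w) / 4| + |(z + 3 * w) / 4|) ^ (p - 2) := by
      refine rpow_le_of_comparable (by norm_num) (by positivity) (by positivity) ?_ ?_ _
      · have a1 : |z| ≤ 3 / 2 * |(3 * z + w) / 4| + 1 / 2 * |(z + 3 * w) / 4| := by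
          rcases abs_cases z with h1 | h1 <;> rcases abs_cases ((3 * z + w) / 4) with h2 | h2 <;>
            rcases abs_cases ((z + 3 * w) / 4) with h3 | h3 <;> linarith
        have a2 : |w| ≤ 3 / 2 * |(z + 3 * w) / 4| + 1 / 2 * |(3 * z + w) / 4| := by
          rcases abs_cases w with h1 | h1 <;> rcases abs_cases ((3 * z + w) / 4) with h2 | h2 <;>
            rcases abs_cases ((z + 3 * w) / 4) with h3 | h3 <;> linarith
        linarith [abs_nonneg ((3 * z + w) / 4), abs_nonneg ((z + 3 * w) / 4)]
      · have a1 : |(3 * z + w) / 4| ≤ |z| + |w| := by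
          rw [abs_le]; constructor <;>
            linarith [neg_abs_le z, neg_abs_le w, le_abs_self z, le_abs_self w]
        have a2 : |(z + 3 * w) / 4| ≤ |z| + |w| := by
          rw [abs_le]; constructor <;>
            linarith [neg_abs_le z, neg_abs_le w, le_abs_self z, le_abs_self w]
        linarith [abs_nonneg z, abs_nonneg w]
    rw [show (3 * z + w) / 4 - (z + 3 * w) / 4 = (z - w) / 2 by ring] at h
    have h' : c / k * E z w ≤ c * ((z - w) ^ 2 *
        (|(3 * z + w) / 4| + |(z + 3 * w) / 4|) ^ (p - 2)) := by
      rw [div_mul_eq_mul_div, div_le_iff₀ hk0, mul_assoc]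
      refine mul_le_mul_of_nonneg_left ?_ hc.le
      rw [hE, mul_assoc]
      refine mul_le_mul_of_nonneg_left ?_ (sq_nonneg _)
      rw [mul_comm _ k]; exact hcomp
    have h'' : c / k * E z w ≤ 2 * ((z - w) * (signedPow ((3 * z + w) / 4) (p - 1) -
        signedPow ((z + 3 * w) / 4) (p - 1))) := by linarith
    calc p / 8 * (c / k) * E z w = p / 8 * (c / k * E z w) := by ring
      _ ≤ p / 8 * _ := mul_le_mul_of_nonneg_left h'' (by positivity)
      _ = _ := by ring
  have hhalf : ∀ l z w : ℝ, 0 ≤ l → l ≤ 1 / 2 → p / 8 * (c / k) * (l * (1 - l) * E z w) ≤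
      l * |z| ^ p + (1 - l) * |w| ^ p - |l * z + (1 - l) * w| ^ p := by
    intro l z w h0 h1
    refine le_trans ?_ (jensen_gap_ge_midpoint hp h0 h1 z w)
    refine le_trans ?_ (mul_le_mul_of_nonneg_left (hmid z w) h0)
    have : 0 ≤ l * l * (p / 8 * (c / k) * E z w) := by
      have := hE0 z w
      positivity
    linarith
  refine ⟨p / 8 * (c / k), by positivity, p * C, by positivity, fun l z w h0 h1 => ⟨?_, ?_⟩⟩
  · rcases le_total l (1 / 2) with h | h
    · exact hhalf l z w h0 h
    · have := hhalf (1 - l) w z (by linarith) (by linarith)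
      have e : E w z = E z w := by simp only [hE]; rw [add_comm |w|]; ring
      rw [e, sub_sub_cancel, add_comm ((1 - l) * w)] at this
      change p / 8 * (c / k) * (l * (1 - l) * E z w) ≤ _
      linarith
  -- The tangents at `z` and `w`, evaluated at the mixture, bound the gap by `p * l * (1 - l)` times
  -- the monotonicity expression.
  · have e1 := mul_le_mul_of_nonneg_left (abs_rpow_tangent hp z (l * z + (1 - l) * w)) h0
    have e2 := mul_le_mul_of_nonneg_left (abs_rpow_tangent hp w (l * z + (1 - l) * w))
      (sub_nonneg.2 h1)
    have e3 := mul_le_mul_of_nonneg_left (H z w).2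
      (mul_nonneg hp0.le (mul_nonneg h0 (sub_nonneg.2 h1)))
    linarith

/-! ### The Picone gap and the simplified energy density -/

/-- The density of the energy of `w ψ` relative to the weight `w` on an edge with
`w = a, b` and `ψ = α, β` at its ends. -/
def piconeGap (p a b α β : ℝ) : ℝ :=
  |a * α - b * β| ^ p - signedPow (a - b) (p - 1) * (a * α ^ p - b * β ^ p)

/-- The simplified energy density, comparable to the Picone gap. -/
def simplifiedDensity (p a b α β : ℝ) : ℝ :=
  a * b * (α - β) ^ 2 * (√(a * b) * |α - β| + (α + β) * |a - b|) ^ (p - 2)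

theorem piconeGap_comm (p a b α β : ℝ) : piconeGap p b a β α = piconeGap p a b α β := by
  rw [piconeGap, piconeGap, abs_sub_comm, ← neg_sub a b, signedPow_neg]; ring

theorem simplifiedDensity_comm (p a b α β : ℝ) :
    simplifiedDensity p b a β α = simplifiedDensity p a b α β := by
  rw [simplifiedDensity, simplifiedDensity, abs_sub_comm β, abs_sub_comm b, add_comm β, mul_comm b,
    ← neg_sub α β, neg_sq]

theorem piconeGap_zero_right {p a α : ℝ} (hp : 1 < p) (ha : 0 ≤ a) (hα : 0 ≤ α) (β : ℝ) :
    piconeGap p a 0 α β = 0 := by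
  have h := mul_signedPow a hp
  rw [piconeGap, zero_mul, zero_mul, sub_zero, sub_zero, sub_zero, abs_of_nonneg (mul_nonneg ha hα),
    Real.mul_rpow ha hα]
  rw [abs_of_nonneg ha] at h
  rw [← h]; ring

/-- With weight `(a - b) / a`, the mixture of `a * α - b * β` and `(a - b) * β` is exactly `(a - b)
* α`. This turns the Picone gap into a Jensen gap. -/
theorem sub_mul_piconeGap {p a b α β : ℝ} (hp : 1 < p) (hα : 0 ≤ α) (hβ : 0 ≤ β)
    (hb : 0 < b) (hab : b < a) :
    (a - b) * piconeGap p a b α β =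
      a * ((a - b) / a * |a * α - b * β| ^ p + (1 - (a - b) / a) * |(a - b) * β| ^ p -
        |(a - b) / a * (a * α - b * β) + (1 - (a - b) / a) * ((a - b) * β)| ^ p) := by
  have ha : 0 < a := hb.trans hab
  have hd : 0 < a - b := sub_pos.2 hab
  have e1 : (a - b) / a * (a * α - b * β) + (1 - (a - b) / a) * ((a - b) * β) = (a - b) * α := by
    field_simp; ring
  have h := mul_signedPow (a - b) hp
  rw [abs_of_pos hd] at h
  rw [e1, abs_of_nonneg (mul_nonneg hd.le hβ), abs_of_nonneg (mul_nonneg hd.le hα),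
    Real.mul_rpow hd.le hβ, Real.mul_rpow hd.le hα, ← h, piconeGap]
  field_simp
  ring

theorem exists_piconeGap_bounds {p : ℝ} (hp : 1 < p) :
    ∃ c > 0, ∃ C > 0, ∀ a b α β : ℝ, 0 < a → 0 < b → 0 ≤ α → 0 ≤ β →
      c * simplifiedDensity p a b α β ≤ piconeGap p a b α β ∧
        piconeGap p a b α β ≤ C * simplifiedDensity p a b α β := by
  obtain ⟨c, hc, C, hC, H⟩ := exists_jensen_gap_bounds hp
  set k : ℝ := 4 ^ |p - 2| with hk
  have hk0 : 0 < k := by positivity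
  have hlt : ∀ a b α β : ℝ, 0 < b → b < a → 0 ≤ α → 0 ≤ β →
      c / k * simplifiedDensity p a b α β ≤ piconeGap p a b α β ∧
        piconeGap p a b α β ≤ C * k * simplifiedDensity p a b α β := by
    intro a b α β hb hab hα hβ
    have ha : 0 < a := hb.trans hab
    have hd : 0 < a - b := sub_pos.2 hab
    -- `N` is the base produced by the Jensen bounds, `S` that of the simplified density. They agree
    -- up to a factor 4 because `b ≤ √(a * b) ≤ a`.
    set N := |a * α - b * β| + |(a - b) * β| with hN
    set S := √(a * b) * |α - β| + (α + β) * |a - b| with hS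
    have hr1 : √(a * b) ≤ a := by
      rw [Real.sqrt_le_left ha.le]; nlinarith
    have hr2 : b ≤ √(a * b) := by
      apply Real.le_sqrt_of_sq_le; nlinarith
    have hdβ : |(a - b) * β| = (a - b) * β := abs_of_nonneg (mul_nonneg hd.le hβ)
    have hda : |a - b| = a - b := abs_of_pos hd
    have hαβ : |α - β| ≤ α + β := by rw [abs_le]; constructor <;> linarith
    have hz : |a * α - b * β| ≤ a * |α - β| + (a - b) * β := by
      have e : a * |α - β| = |a * (α - β)| := by rw [abs_mul, abs_of_pos ha]
      rw [e, ← hdβ]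
      have := abs_add_le (a * (α - β)) ((a - b) * β)
      rwa [show a * (α - β) + (a - b) * β = a * α - b * β by ring] at this
    have hz' : a * |α - β| ≤ |a * α - b * β| + (a - b) * β := by
      have e : a * |α - β| = |a * (α - β)| := by rw [abs_mul, abs_of_pos ha]
      rw [e, ← hdβ]
      have := abs_sub (a * α - b * β) ((a - b) * β)
      rwa [show a * α - b * β - (a - b) * β = a * (α - β) by ring] at this
    have hα' : α ≤ |α - β| + β := by linarith [le_abs_self (α - β)]
    have hNS : N ≤ 4 * S := by
      have : a * |α - β| ≤ √(a * b) * |α - β| + (a - b) * (α + β) := by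
        have h1 := mul_le_mul_of_nonneg_left hαβ hd.le
        have h2 := mul_le_mul_of_nonneg_right hr2 (abs_nonneg (α - β))
        linarith
      have h3 : 0 ≤ √(a * b) * |α - β| := by positivity
      rw [hN, hS, hdβ, hda]
      nlinarith [mul_nonneg hd.le hα, mul_nonneg hd.le hβ]
    have hSN : S ≤ 4 * N := by
      have h1 := mul_le_mul_of_nonneg_right hr1 (abs_nonneg (α - β))
      have h2 := mul_le_mul_of_nonneg_left hα' hd.le
      have h3 := mul_nonneg hb.le (abs_nonneg (α - β))
      have h4 := abs_nonneg (a * α - b * β)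
      rw [hN, hS, hdβ, hda]
      linarith
    have hS0 : 0 ≤ S := by positivity
    have hN0 : 0 ≤ N := by positivity
    have hpow1 := rpow_le_of_comparable (by norm_num) hN0 hS0 hNS hSN (p - 2)
    have hpow2 := rpow_le_of_comparable (by norm_num) hS0 hN0 hSN hNS (p - 2)
    obtain ⟨g1, g2⟩ := H ((a - b) / a) (a * α - b * β) ((a - b) * β) (by positivity)
      (by rw [div_le_one ha]; linarith)
    have e : a * ((a - b) / a * (1 - (a - b) / a) *
        ((a * α - b * β - (a - b) * β) ^ 2 * N ^ (p - 2))) =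
        (a - b) * (a * b * (α - β) ^ 2 * N ^ (p - 2)) := by
      field_simp; ring
    have f1 : c * (a * b * (α - β) ^ 2 * N ^ (p - 2)) ≤ piconeGap p a b α β := by
      refine le_of_mul_le_mul_left ?_ hd
      rw [sub_mul_piconeGap hp hα hβ hb hab, mul_left_comm (a - b), ← e, mul_left_comm c a]
      exact mul_le_mul_of_nonneg_left g1 ha.le
    have f2 : piconeGap p a b α β ≤ C * (a * b * (α - β) ^ 2 * N ^ (p - 2)) := by
      refine le_of_mul_le_mul_left ?_ hd
      rw [sub_mul_piconeGap hp hα hβ hb hab, mul_left_comm (a - b), ← e, mul_left_comm C a]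
      exact mul_le_mul_of_nonneg_left g2 ha.le
    have hQ : 0 ≤ a * b * (α - β) ^ 2 := by positivity
    constructor
    · refine le_trans ?_ f1
      rw [div_mul_eq_mul_div, div_le_iff₀ hk0, simplifiedDensity, ← hS, mul_assoc c]
      refine mul_le_mul_of_nonneg_left ?_ hc.le
      rw [mul_assoc _ _ k, mul_comm _ k]
      exact mul_le_mul_of_nonneg_left hpow2 hQ
    · refine f2.trans ?_
      rw [mul_assoc C, simplifiedDensity, ← hS]
      refine mul_le_mul_of_nonneg_left ?_ hC.le
      rw [mul_left_comm k]
      exact mul_le_mul_of_nonneg_left hpow1 hQ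
  -- For `a = b` the Jensen identity degenerates to `0 = 0`, but gap and density coincide.
  have heq : ∀ a α β : ℝ, 0 < a → 0 ≤ α → 0 ≤ β →
      piconeGap p a a α β = simplifiedDensity p a a α β := by
    intro a α β ha hα hβ
    have h := mul_signedPow (a * (α - β)) hp
    have h2 : ∀ t : ℝ, t * signedPow t (p - 1) = t ^ 2 * |t| ^ (p - 2) := fun t => by
      rw [signedPow, show p - 1 - 1 = p - 2 by ring]; ring
    rw [piconeGap, simplifiedDensity, sub_self, signedPow_zero, ← mul_sub, ← h, h2,
      Real.sqrt_mul_self ha.le, abs_mul, abs_of_pos ha]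
    simp only [zero_mul, sub_zero, abs_zero, mul_zero, add_zero]
    ring
  have hD0 : ∀ a b α β : ℝ, 0 < a → 0 < b → 0 ≤ α → 0 ≤ β → 0 ≤ simplifiedDensity p a b α β := by
    intro a b α β ha hb hα hβ
    unfold simplifiedDensity
    positivity
  refine ⟨min 1 (c / k), by positivity, max 1 (C * k), by positivity,
    fun a b α β ha hb hα hβ => ?_⟩
  have h0 := hD0 a b α β ha hb hα hβ
  suffices h : min 1 (c / k) * simplifiedDensity p a b α β ≤ piconeGap p a b α β ∧
      piconeGap p a b α β ≤ max 1 (C * k) * simplifiedDensity p a b α β from h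
  have m1 := mul_le_mul_of_nonneg_right (min_le_left 1 (c / k)) h0
  have m2 := mul_le_mul_of_nonneg_right (min_le_right 1 (c / k)) h0
  have m3 := mul_le_mul_of_nonneg_right (le_max_left 1 (C * k)) h0
  have m4 := mul_le_mul_of_nonneg_right (le_max_right 1 (C * k)) h0
  rcases lt_trichotomy a b with hab | rfl | hab
  · have h := hlt b a β α ha hab hβ hα
    rw [piconeGap_comm, simplifiedDensity_comm] at h
    exact ⟨m2.trans h.1, h.2.trans m4⟩
  · have h := heq a α β ha hα hβ
    constructor <;> linarith
  · have h := hlt a b α β hb hab hα hβ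
    exact ⟨m2.trans h.1, h.2.trans m4⟩

theorem simplifiedDensity_nonneg {p a b α β : ℝ} (ha : 0 < a) (hb : 0 < b) (hα : 0 ≤ α)
    (hβ : 0 ≤ β) : 0 ≤ simplifiedDensity p a b α β := by
  unfold simplifiedDensity
  positivity

theorem piconeGap_nonneg {p a b α β : ℝ} (hp : 1 < p) (ha : 0 ≤ a) (hb : 0 ≤ b) (hα : 0 ≤ α)
    (hβ : 0 ≤ β) : 0 ≤ piconeGap p a b α β := by
  rcases ha.eq_or_lt with rfl | ha
  · rw [← piconeGap_comm, piconeGap_zero_right hp hb hβ]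
  rcases hb.eq_or_lt with rfl | hb
  · rw [piconeGap_zero_right hp ha.le hα]
  obtain ⟨c, hc, _, _, H⟩ := exists_piconeGap_bounds hp
  exact (mul_nonneg hc.le (simplifiedDensity_nonneg ha hb hα hβ)).trans (H a b α β ha hb hα hβ).1

/-- The simplified density controls the difference of `α` and `β` if `α` is bounded. -/
theorem exists_simplifiedDensity_ge {p a b A η : ℝ} (hp : 1 < p) (ha : 0 < a) (hb : 0 < b)
    (hA : 0 < A) (hη : 0 < η) :
    ∃ κ > 0, ∀ α β : ℝ, 0 ≤ α → α ≤ A → 0 ≤ β → η ≤ |α - β| →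
      κ ≤ simplifiedDensity p a b α β := by
  have hq : 0 < √(a * b) := Real.sqrt_pos.2 (mul_pos ha hb)
  rcases le_total 2 p with h2 | h2
  · refine ⟨a * b * η ^ 2 * (√(a * b) * η) ^ (p - 2), by positivity, fun α β hα hαA hβ h => ?_⟩
    rw [simplifiedDensity, ← sq_abs (α - β)]
    have h0 : 0 ≤ (α + β) * |a - b| := by positivity
    refine mul_le_mul ?_ (Real.rpow_le_rpow (by positivity) ?_ (by linarith)) (by positivity)
      (by positivity)
    · gcongr
    · nlinarith
  -- The exponent is now nonpositive, so the base needs an upper bound. It is at most `K * (|α - β|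
  -- + A)`, which bounds `β` through `α` and the difference; `sq_mul_rpow_mono` then replaces the
  -- difference by `η`.
  · set K := √(a * b) + 2 * |a - b| with hK
    have hK0 : 0 < K := by positivity
    refine ⟨a * b * K ^ (p - 2) * (η ^ 2 * (η + A) ^ (p - 2)), by positivity,
      fun α β hα hαA hβ h => ?_⟩
    have hδ : 0 < |α - β| := hη.trans_le h
    calc a * b * K ^ (p - 2) * (η ^ 2 * (η + A) ^ (p - 2))
        ≤ a * b * K ^ (p - 2) * (|α - β| ^ 2 * (|α - β| + A) ^ (p - 2)) :=
          mul_le_mul_of_nonneg_left (sq_mul_rpow_mono hη.le h hA.le (by linarith)) (by positivity)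
      _ = a * b * |α - β| ^ 2 * (K * (|α - β| + A)) ^ (p - 2) := by
          rw [Real.mul_rpow hK0.le (by positivity)]; ring
      _ ≤ _ := by
          rw [simplifiedDensity, ← sq_abs (α - β)]
          refine mul_le_mul_of_nonneg_left (Real.rpow_le_rpow_of_nonpos (by positivity) ?_
            (by linarith)) (by positivity)
          have h1 : β ≤ α + |α - β| := by linarith [neg_abs_le (α - β)]
          have h3 : α + β ≤ 2 * (|α - β| + A) := by linarith
          have h4 := mul_le_mul_of_nonneg_right h3 (abs_nonneg (a - b))
          have h5 : 0 ≤ √(a * b) * A := by positivity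
          rw [hK]
          linarith

theorem eq_of_piconeGap_eq_zero {p a b α β : ℝ} (hp : 1 < p) (ha : 0 < a) (hb : 0 < b)
    (hα : 0 ≤ α) (hβ : 0 ≤ β) (h : piconeGap p a b α β = 0) : α = β := by
  by_contra hne
  obtain ⟨c, hc, _, _, H⟩ := exists_piconeGap_bounds hp
  obtain ⟨κ, hκ, hκ'⟩ := exists_simplifiedDensity_ge (A := α + 1) hp ha hb (by linarith)
    (abs_pos.2 (sub_ne_zero.2 hne))
  have h1 := hκ' α β hα (by linarith) hβ le_rfl
  have h2 := (H a b α β ha hb hα hβ).1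
  nlinarith

/-- Transports a limit across one edge. The convergent sequence `α` is eventually below `l + 1`,
which gives the bound required by `exists_simplifiedDensity_ge`. -/
theorem tendsto_of_piconeGap_tendsto_zero {p a b l : ℝ} (hp : 1 < p) (ha : 0 < a) (hb : 0 < b)
    {α β : ℕ → ℝ} (hα : ∀ n, 0 ≤ α n) (hβ : ∀ n, 0 ≤ β n)
    (hl : Tendsto α atTop (nhds l))
    (h : Tendsto (fun n => piconeGap p a b (α n) (β n)) atTop (nhds 0)) :
    Tendsto β atTop (nhds l) := by
  obtain ⟨c, hc, _, _, H⟩ := exists_piconeGap_bounds hp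
  suffices hd : Tendsto (fun n => α n - β n) atTop (nhds 0) by
    simpa using hl.sub hd
  have hl0 : 0 ≤ l := ge_of_tendsto' hl hα
  rw [Metric.tendsto_nhds]
  intro η hη
  obtain ⟨κ, hκ, hκ'⟩ := exists_simplifiedDensity_ge (A := l + 1) hp ha hb (by linarith) hη
  filter_upwards [h.eventually_lt_const (mul_pos hc hκ),
    hl.eventually_lt_const (by linarith : l < l + 1)] with n h1 h2
  rw [Real.dist_eq, sub_zero]
  by_contra! h3
  have h4 := hκ' _ _ (hα n) h2.le (hβ n) h3
  have h5 := (H a b _ _ ha hb (hα n) (hβ n)).1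
  nlinarith

/-! ### Comparison of two weighted densities -/

/-- Splitting `k` as `k ^ (2 / p) * k ^ ((p - 2) / p)` gives the form `x ^ 2 * (x + y) ^ (p - 2)`,
whose entries are those compared by the weight and gradient hypotheses. -/
theorem mul_simplifiedDensity {p k a b α β : ℝ} (hp : 1 < p) (hk : 0 < k) (ha : 0 ≤ a) (hb : 0 ≤ b)
    (hα : 0 ≤ α) (hβ : 0 ≤ β) :
    k * simplifiedDensity p a b α β =
      (√(k ^ (2 / p) * (a * b)) * |α - β|) ^ 2 *
        (√(k ^ (2 / p) * (a * b)) * |α - β| + (α + β) * (k ^ (1 / p) * |a - b|)) ^ (p - 2) := by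
  have hp0 : p ≠ 0 := by linarith
  have hk2 : k ^ (2 / p) = (k ^ (1 / p)) ^ 2 := by
    rw [← Real.rpow_natCast, ← Real.rpow_mul hk.le]; congr 1; push_cast; ring
  have hk1 : 0 < k ^ (1 / p) := Real.rpow_pos_of_pos hk _
  have hab : 0 ≤ a * b := mul_nonneg ha hb
  have hkp : k = (k ^ (1 / p)) ^ 2 * (k ^ (1 / p)) ^ (p - 2) := by
    rw [← Real.rpow_natCast, ← Real.rpow_add hk1, ← Real.rpow_mul hk.le]
    rw [show 1 / p * ((2 : ℕ) + (p - 2)) = 1 by push_cast; field_simp; ring, Real.rpow_one]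
  have hs : √(k ^ (2 / p) * (a * b)) = k ^ (1 / p) * √(a * b) := by
    rw [hk2, Real.sqrt_mul (by positivity), Real.sqrt_sq hk1.le]
  rw [hs, show k ^ (1 / p) * √(a * b) * |α - β| + (α + β) * (k ^ (1 / p) * |a - b|) =
    k ^ (1 / p) * (√(a * b) * |α - β| + (α + β) * |a - b|) by ring,
    Real.mul_rpow hk1.le (by positivity), mul_pow, mul_pow, sq_abs, Real.sq_sqrt hab,
    simplifiedDensity]
  conv_lhs => rw [hkp]
  ring

theorem density_le_of_two_le {p L x x' y y' : ℝ} (hp : 2 ≤ p) (hL : 1 ≤ L) (hx : 0 ≤ x)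
    (hx' : 0 ≤ x') (hy : 0 ≤ y) (hy' : 0 ≤ y') (hxx : x ≤ L * x') (hyy : y ≤ L * y') :
    x ^ 2 * (x + y) ^ (p - 2) ≤ L ^ 2 * L ^ |p - 2| * (x' ^ 2 * (x' + y') ^ (p - 2)) := by
  have hL0 : 0 < L := by linarith
  have h1 : (x + y) ^ (p - 2) ≤ L ^ |p - 2| * (x' + y') ^ (p - 2) := by
    rw [abs_of_nonneg (by linarith), ← Real.mul_rpow hL0.le (by positivity)]
    exact Real.rpow_le_rpow (by positivity) (by linarith) (by linarith)
  have h2 : x ^ 2 ≤ L ^ 2 * x' ^ 2 := by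
    rw [← mul_pow]; exact pow_le_pow_left₀ hx hxx 2
  calc x ^ 2 * (x + y) ^ (p - 2) ≤ L ^ 2 * x' ^ 2 * (L ^ |p - 2| * (x' + y') ^ (p - 2)) :=
        mul_le_mul h2 h1 (by positivity) (by positivity)
    _ = _ := by ring

/-- For `p ≤ 2` the density still grows with `x` but is nonincreasing in `y`, so the bound on `y` is
needed in the reverse direction. The negative exponent in the gradient hypothesis provides it. -/
theorem density_le_of_le_two {p L x x' y y' : ℝ} (hp1 : 1 < p) (hp : p ≤ 2) (hL : 1 ≤ L)
    (hx : 0 ≤ x) (hx' : 0 ≤ x') (hy : 0 ≤ y) (hy' : 0 ≤ y') (hxx : x ≤ L * x')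
    (hyy : y' ≤ L * y) :
    x ^ 2 * (x + y) ^ (p - 2) ≤ L ^ 2 * L ^ |p - 2| * (x' ^ 2 * (x' + y') ^ (p - 2)) := by
  have hL0 : 0 < L := by linarith
  refine (sq_mul_rpow_mono hx hxx hy (by linarith : -1 ≤ p - 2)).trans ?_
  rcases hx'.eq_or_lt with rfl | hx'
  · simp
  have h1 : (L * x' + y) ^ (p - 2) ≤ L ^ |p - 2| * (x' + y') ^ (p - 2) := by
    rw [abs_of_nonpos (by linarith), Real.rpow_neg hL0.le, ← Real.inv_rpow hL0.le,
      ← Real.mul_rpow (by positivity) (by positivity)]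
    refine Real.rpow_le_rpow_of_nonpos (by positivity) ?_ (by linarith)
    rw [inv_mul_le_iff₀ hL0]
    nlinarith [mul_le_mul_of_nonneg_right hL hx'.le]
  calc (L * x') ^ 2 * (L * x' + y) ^ (p - 2)
      ≤ (L * x') ^ 2 * (L ^ |p - 2| * (x' + y') ^ (p - 2)) :=
        mul_le_mul_of_nonneg_left h1 (by positivity)
    _ = _ := by ring

/-- The real form of the hypothesis on the gradients. -/
theorem gradientWeight_eq {X : Type*} {p : ℝ} (hp : 1 < p) {b : X → X → ℝ} {f : X → ℝ} {x y : X}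
    (hb : 0 < b x y) :
    gradientWeight p b f x y = ENNReal.ofReal (b x y ^ (1 / p) * |f x - f y|) ^ (p - 2) := by
  have hk : 0 < b x y ^ (1 / p) := Real.rpow_pos_of_pos hb _
  have hp0 : p ≠ 0 := by linarith
  have h1 : ENNReal.ofReal (b x y) ^ (1 - 2 / p) = ENNReal.ofReal (b x y ^ (1 / p)) ^ (p - 2) := by
    rw [ENNReal.ofReal_rpow_of_pos hb, ENNReal.ofReal_rpow_of_pos hk, ← Real.rpow_mul hb.le]
    congr 2; field_simp
  rw [gradientWeight, h1, ENNReal.ofReal_mul hk.le, ENNReal.mul_rpow_eq_ite]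
  rw [if_neg]
  rintro ⟨h | h, -⟩
  · exact (ENNReal.ofReal_pos.2 hk).ne' h.1
  · exact ENNReal.ofReal_ne_top h.1

theorem le_of_rpow_le_of_pos {r C s t : ℝ} (hr : 0 < r) (hC : 0 < C) (hs : 0 ≤ s) (ht : 0 ≤ t)
    (h : ENNReal.ofReal s ^ r ≤ ENNReal.ofReal C * ENNReal.ofReal t ^ r) :
    s ≤ C ^ (1 / r) * t := by
  rw [ENNReal.ofReal_rpow_of_nonneg hs hr.le, ENNReal.ofReal_rpow_of_nonneg ht hr.le,
    ← ENNReal.ofReal_mul hC.le, ENNReal.ofReal_le_ofReal_iff (by positivity)] at h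
  have h2 := Real.rpow_le_rpow (by positivity) h (by positivity : 0 ≤ 1 / r)
  rwa [Real.mul_rpow hC.le (by positivity), ← Real.rpow_mul hs, ← Real.rpow_mul ht,
    mul_one_div_cancel hr.ne', Real.rpow_one, Real.rpow_one] at h2

theorem le_of_rpow_le_of_neg {r C s t : ℝ} (hr : r < 0) (hC : 0 < C) (hs : 0 ≤ s) (ht : 0 ≤ t)
    (h : ENNReal.ofReal s ^ r ≤ ENNReal.ofReal C * ENNReal.ofReal t ^ r) :
    t ≤ C ^ (1 / (-r)) * s := by
  rcases ht.eq_or_lt with rfl | ht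
  · positivity
  rcases hs.eq_or_lt with rfl | hs
  · rw [ENNReal.ofReal_zero, ENNReal.zero_rpow_of_neg hr, top_le_iff,
      ENNReal.ofReal_rpow_of_pos ht] at h
    exact absurd h (ENNReal.mul_ne_top ENNReal.ofReal_ne_top ENNReal.ofReal_ne_top)
  rw [ENNReal.ofReal_rpow_of_pos hs, ENNReal.ofReal_rpow_of_pos ht,
    ← ENNReal.ofReal_mul hC.le, ENNReal.ofReal_le_ofReal_iff (by positivity)] at h
  have h1 : t ^ (-r) ≤ C * s ^ (-r) := by
    rw [Real.rpow_neg ht.le, Real.rpow_neg hs.le]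
    have hs' := Real.rpow_pos_of_pos hs r
    have ht' := Real.rpow_pos_of_pos ht r
    rw [← div_eq_mul_inv, le_div_iff₀ hs', inv_mul_le_iff₀ ht', mul_comm]
    exact h
  have hr' : 0 < -r := by linarith
  have h2 := Real.rpow_le_rpow (by positivity) h1 (by positivity : 0 ≤ 1 / (-r))
  rwa [Real.mul_rpow hC.le (by positivity), ← Real.rpow_mul hs.le, ← Real.rpow_mul ht.le,
    mul_one_div_cancel hr'.ne', Real.rpow_one, Real.rpow_one] at h2

/-- The hypotheses of the Liouville comparison principle bound the weighted Picone gap of `u` by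
the one of `v`. -/
theorem exists_piconeGap_comparison {X : Type*} {p : ℝ} (hp : 1 < p) {b b' : X → X → ℝ}
    (hb : ∀ x y, 0 ≤ b x y) (hb' : ∀ x y, 0 ≤ b' x y) {u v : X → ℝ} (hu : ∀ x, 0 ≤ u x)
    (hv : ∀ x, 0 < v x) {C : ℝ} (hC : 0 < C)
    (h_weight : ∀ x y, 0 < u x → 0 < u y →
      b x y ^ (2 / p) * (u x * u y) ≤ C * (b' x y ^ (2 / p) * (v x * v y)))
    (h_grad : ∀ x y, 0 < u x → 0 < u y → 0 < b x y →
      gradientWeight p b u x y ≤ ENNReal.ofReal C * gradientWeight p b' v x y) :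
    ∃ K > 0, ∀ (ψ : X → ℝ), (∀ x, 0 ≤ ψ x) → ∀ x y,
      b x y * piconeGap p (u x) (u y) (ψ x) (ψ y) ≤
        K * (b' x y * piconeGap p (v x) (v y) (ψ x) (ψ y)) := by
  obtain ⟨c₁, hc₁, C₁, hC₁, H⟩ := exists_piconeGap_bounds hp
  -- `√C` comes from the weight hypothesis, the last term from inverting the power `p - 2`; for `p =
  -- 2` it equals 1.
  set L := 1 + √C + C ^ (1 / |p - 2|) with hL
  have hCp : 0 ≤ C ^ (1 / |p - 2|) := Real.rpow_nonneg hC.le _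
  have hL1 : 1 ≤ L := by have := Real.sqrt_nonneg C; linarith
  have hL0 : 0 < L := by linarith
  set M := L ^ 2 * L ^ |p - 2| with hM
  have hM0 : 0 < M := by positivity
  refine ⟨C₁ * M / c₁, by positivity, fun ψ hψ x y => ?_⟩
  have hgap := piconeGap_nonneg hp (hv x).le (hv y).le (hψ x) (hψ y)
  have hR : 0 ≤ C₁ * M / c₁ * (b' x y * piconeGap p (v x) (v y) (ψ x) (ψ y)) :=
    mul_nonneg (by positivity) (mul_nonneg (hb' x y) hgap)
  rcases (hu x).eq_or_lt with hx | hx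
  · rwa [← hx, ← piconeGap_comm, piconeGap_zero_right hp (hu y) (hψ y), mul_zero]
  rcases (hu y).eq_or_lt with hy | hy
  · rwa [← hy, piconeGap_zero_right hp (hu x) (hψ x), mul_zero]
  rcases (hb x y).eq_or_lt with hxy | hxy
  · rwa [← hxy, zero_mul]
  have hw := h_weight x y hx hy
  -- The weight hypothesis forces an edge of `b` inside the positivity set of `u` to be an edge of
  -- `b'`.
  have hb'xy : 0 < b' x y := by
    refine (hb' x y).lt_of_ne fun h => ?_
    rw [← h, Real.zero_rpow (by positivity), zero_mul, mul_zero] at hw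
    have : 0 < b x y ^ (2 / p) * (u x * u y) := by positivity
    linarith
  have hgr := h_grad x y hx hy hxy
  rw [gradientWeight_eq hp hxy, gradientWeight_eq hp hb'xy] at hgr
  have hX : √(b x y ^ (2 / p) * (u x * u y)) ≤ L * √(b' x y ^ (2 / p) * (v x * v y)) := by
    refine (Real.sqrt_le_sqrt hw).trans ?_
    rw [Real.sqrt_mul hC.le]
    exact mul_le_mul_of_nonneg_right (by linarith) (Real.sqrt_nonneg _)
  have hX' : √(b x y ^ (2 / p) * (u x * u y)) * |ψ x - ψ y| ≤
      L * (√(b' x y ^ (2 / p) * (v x * v y)) * |ψ x - ψ y|) := by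
    rw [← mul_assoc L]; exact mul_le_mul_of_nonneg_right hX (abs_nonneg _)
  have hψ2 : 0 ≤ ψ x + ψ y := add_nonneg (hψ x) (hψ y)
  have hbv : (0 : ℝ) ≤ b' x y ^ (1 / p) * |v x - v y| := by positivity
  have hbu : (0 : ℝ) ≤ b x y ^ (1 / p) * |u x - u y| := by positivity
  have hLC : C ^ (1 / |p - 2|) ≤ L := by have := Real.sqrt_nonneg C; linarith
  have hdens : b x y * simplifiedDensity p (u x) (u y) (ψ x) (ψ y) ≤
      M * (b' x y * simplifiedDensity p (v x) (v y) (ψ x) (ψ y)) := by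
    rw [mul_simplifiedDensity hp hxy (hu x) (hu y) (hψ x) (hψ y),
      mul_simplifiedDensity hp hb'xy (hv x).le (hv y).le (hψ x) (hψ y)]
    rcases lt_trichotomy p 2 with h2 | h2 | h2
    · refine density_le_of_le_two hp h2.le hL1 (by positivity) (by positivity) (by positivity)
        (by positivity) hX' ?_
      have := le_of_rpow_le_of_neg (by linarith) hC hbu hbv hgr
      rw [← abs_of_neg (by linarith : p - 2 < 0)] at this
      have := this.trans (mul_le_mul_of_nonneg_right hLC hbu)
      rw [mul_left_comm L]
      exact mul_le_mul_of_nonneg_left this hψ2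
    · rw [hM, h2, sub_self, abs_zero, Real.rpow_zero, Real.rpow_zero, Real.rpow_zero, mul_one,
        mul_one, mul_one, ← mul_pow]
      rw [h2] at hX'
      exact pow_le_pow_left₀ (by positivity) hX' 2
    · refine density_le_of_two_le h2.le hL1 (by positivity) (by positivity) (by positivity)
        (by positivity) hX' ?_
      have := le_of_rpow_le_of_pos (by linarith) hC hbu hbv hgr
      rw [← abs_of_pos (by linarith : 0 < p - 2)] at this
      have := this.trans (mul_le_mul_of_nonneg_right hLC hbv)
      rw [mul_left_comm L]
      exact mul_le_mul_of_nonneg_left this hψ2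
  have g1 := mul_le_mul_of_nonneg_left (H _ _ _ _ hx hy (hψ x) (hψ y)).2 hxy.le
  have g2 := mul_le_mul_of_nonneg_left (H _ _ _ _ (hv x) (hv y) (hψ x) (hψ y)).1 hb'xy.le
  have g3 := mul_le_mul_of_nonneg_left hdens hC₁.le
  rw [div_mul_eq_mul_div, le_div_iff₀ hc₁]
  have g4 := mul_le_mul_of_nonneg_left g2 (mul_pos hC₁ hM0).le
  have g5 := mul_le_mul_of_nonneg_right (g1.trans (by linarith [g3])) hc₁.le
    (c := C₁ * (M * (b' x y * simplifiedDensity p (v x) (v y) (ψ x) (ψ y))))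
  linarith

/-! ### Sums over the edges -/

section Energy

variable {X : Type*} {p : ℝ} {b : X → X → ℝ} {m V : X → ℝ}

theorem summable_fst_mul {ζ : X → ℝ} (hζ : ζ.support.Finite) {k : X → X → ℝ}
    (hk : ∀ x, Summable (k x)) : Summable fun q : X × X => ζ q.1 * k q.1 q.2 := by
  rw [← summable_abs_iff, summable_prod_of_nonneg fun _ => abs_nonneg _]
  refine ⟨fun x => ((hk x).mul_left (ζ x)).abs, summable_of_hasFiniteSupport (hζ.subset ?_)⟩
  intro x hx hx0
  apply hx
  simp [hx0]

theorem tsum_fst_mul {ζ : X → ℝ} (hζ : ζ.support.Finite) {k : X → X → ℝ}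
    (hk : ∀ x, Summable (k x)) :
    ∑' q : X × X, ζ q.1 * k q.1 q.2 = ∑' x, ζ x * ∑' y, k x y := by
  rw [(summable_fst_mul hζ hk).tsum_prod]
  simp only [tsum_mul_left]

theorem summable_mul_signedPow (hp : 1 < p) (hb : IsConnectedGraph b) {f : X → ℝ}
    (hf : f ∈ formalDomain p b) (x : X) :
    Summable fun y => b x y * signedPow (f x - f y) (p - 1) := by
  rw [← summable_abs_iff]
  refine (hf x).congr fun y => ?_
  rw [abs_mul, abs_of_nonneg (hb.nonneg x y), abs_signedPow _ (by linarith)]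

theorem summable_energy (hp : 1 < p) (hb : IsConnectedGraph b) {φ : X → ℝ}
    (hφ : φ.support.Finite) : Summable fun q : X × X => b q.1 q.2 * |φ q.1 - φ q.2| ^ p := by
  have hφp : (fun x => |φ x| ^ p).support.Finite := hφ.subset fun x hx hx0 => by
    apply hx
    simp [hx0, Real.zero_rpow (by linarith : p ≠ 0)]
  have h1 := summable_fst_mul hφp hb.summable
  have h2 : Summable fun q : X × X => |φ q.2| ^ p * b q.1 q.2 := by
    rw [← (Equiv.prodComm X X).summable_iff]
    refine h1.congr fun q => ?_
    simp [hb.symm q.2 q.1]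
  refine Summable.of_nonneg_of_le
    (fun q => mul_nonneg (hb.nonneg _ _) (Real.rpow_nonneg (abs_nonneg _) _)) (fun q => ?_)
    ((h1.add h2).mul_left (1 / 2 * 2 ^ p))
  have h := abs_rpow_convex hp (l := 1 / 2) (by norm_num) (by norm_num) (2 * φ q.1) (-(2 * φ q.2))
  rw [abs_neg, abs_mul, abs_mul, abs_two, Real.mul_rpow two_pos.le (abs_nonneg _),
    Real.mul_rpow two_pos.le (abs_nonneg _),
    show 1 / 2 * (2 * φ q.1) + (1 - 1 / 2) * -(2 * φ q.2) = φ q.1 - φ q.2 by ring] at h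
  have := mul_le_mul_of_nonneg_left h (hb.nonneg q.1 q.2)
  linarith

theorem support_mul_rpow_finite (hp : 1 < p) {ψ : X → ℝ} (hψ : ψ.support.Finite) (w : X → ℝ) :
    (fun x => w x * ψ x ^ p).support.Finite := hψ.subset fun x hx hx0 => by
  apply hx
  simp [hx0, Real.zero_rpow (by linarith : p ≠ 0)]

theorem summable_piconeGap (hp : 1 < p) (hb : IsConnectedGraph b) {w ψ : X → ℝ}
    (hw : w ∈ formalDomain p b) (hψ : ψ.support.Finite) :
    Summable fun q : X × X => b q.1 q.2 * piconeGap p (w q.1) (w q.2) (ψ q.1) (ψ q.2) := by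
  have hζ := support_mul_rpow_finite hp hψ w
  have hA := summable_fst_mul hζ (summable_mul_signedPow hp hb hw)
  have hB : Summable fun q : X × X =>
      w q.2 * ψ q.2 ^ p * (b q.1 q.2 * signedPow (w q.1 - w q.2) (p - 1)) := by
    rw [← (Equiv.prodComm X X).summable_iff]
    refine hA.neg.congr fun q => ?_
    simp only [Function.comp_apply, Equiv.prodComm_apply, Prod.fst_swap, Prod.snd_swap]
    rw [hb.symm q.2 q.1, ← neg_sub (w q.1), signedPow_neg]
    ring
  have hE := summable_energy hp hb (φ := fun x => w x * ψ x)
    (hψ.subset fun x hx hx0 => hx (by simp [hx0]))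
  refine (hE.sub (hA.sub hB)).congr fun q => ?_
  rw [piconeGap]
  ring

/-- Discrete Picone identity: test `H[w]` against `w * ψ ^ p` and symmetrise the edge sum. Finite
support of `ψ` and membership in `formalDomain` give absolute convergence without local finiteness.
-/
theorem energy_mul_eq (hp : 1 < p) (hb : IsConnectedGraph b) (hm : ∀ x, 0 < m x) {w ψ : X → ℝ}
    (hw : w ∈ formalDomain p b) (hψ0 : ∀ x, 0 ≤ ψ x) (hψ : ψ.support.Finite) :
    energy p b m V (fun x => w x * ψ x) =
      1 / 2 * ∑' q : X × X, b q.1 q.2 * piconeGap p (w q.1) (w q.2) (ψ q.1) (ψ q.2) +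
        ∑' x, m x * (w x * ψ x ^ p) * schrodinger p b m V w x := by
  have hζ := support_mul_rpow_finite hp hψ w
  have hA := summable_fst_mul hζ (summable_mul_signedPow hp hb hw)
  have hAs := tsum_fst_mul hζ (summable_mul_signedPow hp hb hw)
  set A := ∑' x, w x * ψ x ^ p * ∑' y, b x y * signedPow (w x - w y) (p - 1) with hAdef
  have hB : HasSum (fun q : X × X =>
      w q.2 * ψ q.2 ^ p * (b q.1 q.2 * signedPow (w q.1 - w q.2) (p - 1))) (-A) := by
    rw [← (Equiv.prodComm X X).hasSum_iff, ← hAs]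
    refine hA.hasSum.neg.congr_fun fun q => ?_
    simp only [Function.comp_apply, Equiv.prodComm_apply, Prod.fst_swap, Prod.snd_swap]
    rw [hb.symm q.2 q.1, ← neg_sub (w q.1), signedPow_neg]
    ring
  have hD := (summable_piconeGap hp hb hw hψ).hasSum
  have hE : HasSum (fun q : X × X => b q.1 q.2 * |w q.1 * ψ q.1 - w q.2 * ψ q.2| ^ p)
      ((∑' q : X × X, b q.1 q.2 * piconeGap p (w q.1) (w q.2) (ψ q.1) (ψ q.2)) +
        (A - -A)) := by
    convert hD.add ((hAs ▸ hA.hasSum).sub hB) using 1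
    ext q
    rw [piconeGap]
    ring
  have hA' : A = ∑' x, m x * (w x * ψ x ^ p) * pLaplacian p b m w x := by
    refine tsum_congr fun x => ?_
    have := (hm x).ne'
    rw [pLaplacian]
    field_simp
  have hV : ∀ x, m x * V x * |w x * ψ x| ^ p =
      m x * (w x * ψ x ^ p) * (V x * signedPow (w x) (p - 1)) := fun x => by
    have h := mul_signedPow (w x) hp
    rw [abs_mul, Real.mul_rpow (abs_nonneg _) (abs_nonneg _), ← h, abs_of_nonneg (hψ0 x)]
    ring
  have hs : ∀ f : X → ℝ, Summable fun x => m x * (w x * ψ x ^ p) * f x := fun f =>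
    summable_of_hasFiniteSupport (hζ.subset fun x hx hx0 => hx (by
      change w x * ψ x ^ p = 0 at hx0
      simp only [hx0, mul_zero, zero_mul]))
  rw [energy, hE.tsum_eq, tsum_congr hV]
  simp only [schrodinger, mul_add]
  rw [Summable.tsum_add (by simpa only [mul_assoc] using hs _)
    (by simpa only [mul_assoc] using hs _), ← hA']
  ring

/-! ### Sub- and superharmonic functions -/

/-- At a zero of `s` the potential term vanishes and `Δ_p s` is a sum of nonpositive terms, so all
neighbours are zeros too; connectedness spreads this to `X`. -/
theorem IsSuperharmonic.pos (hp : 1 < p) (hb : IsConnectedGraph b) (hm : ∀ x, 0 < m x)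
    {s : X → ℝ} (hs : IsSuperharmonic p b m V s) (hs0 : 0 ≤ s) (hne : s ≠ 0) (x : X) :
    0 < s x := by
  have hstep : ∀ x y, s x = 0 → 0 < b x y → s y = 0 := by
    intro x y hx hxy
    have h := hs.2 x
    have hsum := summable_mul_signedPow hp hb hs.1 x
    rw [schrodinger, hx, signedPow_zero, mul_zero, add_zero, pLaplacian,
      mul_nonneg_iff_of_pos_left (one_div_pos.2 (hm x))] at h
    have hterm : ∀ z, b x z * signedPow (s x - s z) (p - 1) ≤ 0 := fun z => by
      have : signedPow (s x - s z) (p - 1) ≤ signedPow 0 (p - 1) :=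
        signedPow_mono (by linarith) (by
          have : 0 ≤ s z := hs0 z
          linarith)
      rw [signedPow_zero] at this
      exact mul_nonpos_of_nonneg_of_nonpos (hb.nonneg x z) this
    have hy : 0 ≤ b x y * signedPow (s x - s y) (p - 1) := by
      have := hsum.neg.le_tsum y fun z _ => neg_nonneg.2 (hterm z)
      rw [tsum_neg] at this
      linarith
    have hy0 : b x y * signedPow (s x - s y) (p - 1) = 0 := le_antisymm (hterm y) hy
    have h0 := (mul_eq_zero.1 hy0).resolve_left hxy.ne'
    have habs := abs_signedPow (s x - s y) (by linarith : 0 < p - 1)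
    rw [h0, abs_zero, eq_comm, Real.rpow_eq_zero (abs_nonneg _) (by linarith), abs_eq_zero] at habs
    linarith
  refine (hs0 x).lt_of_ne fun hx => hne (funext fun y => ?_)
  induction hb.connected x y with
  | refl => exact hx.symm
  | tail _ hxy ih => exact hstep _ _ ih hxy

theorem IsSubharmonic.posPart (hp : 1 < p) (hb : IsConnectedGraph b) (hm : ∀ x, 0 < m x)
    {u : X → ℝ} (hu : IsSubharmonic p b m V u) : IsSubharmonic p b m V u⁺ := by
  have hdom : u⁺ ∈ formalDomain p b := fun x => by
    refine Summable.of_nonneg_of_le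
      (fun y => mul_nonneg (hb.nonneg _ _) (Real.rpow_nonneg (abs_nonneg _) _)) (fun y => ?_) (hu.1 x)
    refine mul_le_mul_of_nonneg_left (Real.rpow_le_rpow (abs_nonneg _) ?_ (by linarith))
      (hb.nonneg x y)
    simpa only [Pi.posPart_apply, posPart_def] using abs_max_sub_max_le_abs (u x) (u y) 0
  refine ⟨hdom, fun x => ?_⟩
  have hsum := summable_mul_signedPow hp hb hdom x
  have hm' : 0 < 1 / m x := one_div_pos.2 (hm x)
  rcases le_or_gt (u x) 0 with hx | hx
  · have hx0 : u⁺ x = 0 := by simpa [Pi.posPart_apply] using hx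
    rw [schrodinger, hx0, signedPow_zero, mul_zero, add_zero, pLaplacian]
    refine mul_nonpos_of_nonneg_of_nonpos hm'.le (tsum_nonpos fun y => ?_)
    have : signedPow (u⁺ x - u⁺ y) (p - 1) ≤ signedPow 0 (p - 1) :=
      signedPow_mono (by linarith) (by
        rw [hx0, Pi.posPart_apply]; linarith [posPart_nonneg (u y)])
    rw [signedPow_zero] at this
    exact mul_nonpos_of_nonneg_of_nonpos (hb.nonneg x y) this
  · have hx0 : u⁺ x = u x := by simpa [Pi.posPart_apply] using hx.le
    refine le_trans ?_ (hu.2 x)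
    rw [schrodinger, schrodinger, pLaplacian, pLaplacian]
    have : ∑' y, b x y * signedPow (u⁺ x - u⁺ y) (p - 1) ≤
        ∑' y, b x y * signedPow (u x - u y) (p - 1) := by
      refine hsum.tsum_le_tsum (fun y => ?_) (summable_mul_signedPow hp hb hu.1 x)
      refine mul_le_mul_of_nonneg_left (signedPow_mono (by linarith) ?_) (hb.nonneg x y)
      rw [hx0, Pi.posPart_apply]
      linarith [le_posPart (u y)]
    rw [hx0] at this ⊢
    linarith [mul_le_mul_of_nonneg_left this hm'.le]

/-! ### Null sequences -/

theorem energy_abs_le (hp : 1 < p) (hb : IsConnectedGraph b) {φ : X → ℝ}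
    (hφ : φ.support.Finite) : energy p b m V (fun x => |φ x|) ≤ energy p b m V φ := by
  have habs : (fun x => |φ x|).support.Finite := hφ.subset fun x hx hx0 => hx (by simp [hx0])
  rw [energy, energy]
  simp only [abs_abs]
  have h : ∀ q : X × X, b q.1 q.2 * |(|φ q.1| - |φ q.2|)| ^ p ≤ b q.1 q.2 * |φ q.1 - φ q.2| ^ p :=
    fun q => mul_le_mul_of_nonneg_left (Real.rpow_le_rpow (abs_nonneg _)
      (abs_abs_sub_abs_le (φ q.1) (φ q.2)) (by linarith)) (hb.nonneg q.1 q.2)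
  have := (summable_energy hp hb habs).tsum_le_tsum h (summable_energy hp hb hφ)
  linarith

theorem energy_const_mul {c : ℝ} (hc : 0 ≤ c) (φ : X → ℝ) :
    energy p b m V (fun x => c * φ x) = c ^ p * energy p b m V φ := by
  have h1 : ∀ q : X × X, b q.1 q.2 * |c * φ q.1 - c * φ q.2| ^ p =
      c ^ p * (b q.1 q.2 * |φ q.1 - φ q.2| ^ p) := fun q => by
    rw [← mul_sub, abs_mul, abs_of_nonneg hc, Real.mul_rpow hc (abs_nonneg _)]; ring
  have h2 : ∀ x, m x * V x * |c * φ x| ^ p = c ^ p * (m x * V x * |φ x| ^ p) := fun x => by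
    rw [abs_mul, abs_of_nonneg hc, Real.mul_rpow hc (abs_nonneg _)]; ring
  rw [energy, energy, tsum_congr h1, tsum_congr h2, tsum_mul_left, tsum_mul_left]
  ring

theorem energy_sub_single [DecidableEq X] (hp : 1 < p) {φ : X → ℝ} (hφ : φ.support.Finite) (o : X)
    (η : ℝ) :
    energy p b m (V - Pi.single o η) φ = energy p b m V φ - m o * η * |φ o| ^ p := by
  have hs : ∀ f : X → ℝ, Summable fun x => m x * f x * |φ x| ^ p := fun f =>
    summable_of_hasFiniteSupport (hφ.subset fun x hx hx0 => hx (by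
      simp [hx0, Real.zero_rpow (by linarith : p ≠ 0)]))
  have h : ∑' x, m x * (Pi.single o η : X → ℝ) x * |φ x| ^ p = m o * η * |φ o| ^ p := by
    rw [tsum_eq_single o fun x hx => by simp [hx]]
    simp
  rw [energy, energy, ← h, add_sub_assoc, ← (hs V).tsum_sub (hs _)]
  congr 2
  ext x
  simp only [Pi.sub_apply]
  ring

/-- Criticality is tested with a point mass at `o`. The resulting `φ` cannot vanish at `o`, since
its energy would then be negative; it is replaced by `|φ|` and rescaled. -/
theorem IsCritical.exists_energy_lt (hp : 1 < p) (hb : IsConnectedGraph b) (hm : ∀ x, 0 < m x)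
    (hcrit : IsCritical p b m V) {v : X → ℝ} (hv : ∀ x, 0 < v x) (o : X) {ε : ℝ} (hε : 0 < ε) :
    ∃ ψ : X → ℝ, (∀ x, 0 ≤ ψ x) ∧ ψ.support.Finite ∧ ψ o = 1 ∧
      energy p b m V (fun x => v x * ψ x) < ε := by
  classical
  have hvo : 0 < v o ^ p := Real.rpow_pos_of_pos (hv o) p
  have hmo := hm o
  -- Chosen so that, once `|φ|` is scaled to the value `v o` at `o`, the energy bound becomes
  -- exactly `ε`.
  set η := ε / (m o * v o ^ p) with hη
  have hη0 : 0 < η := by positivity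
  obtain ⟨φ, hφ, hlt⟩ : ∃ φ : X → ℝ, φ.support.Finite ∧
      energy p b m (V - Pi.single o η) φ < 0 := by
    by_contra! h
    exact hcrit.2 ⟨Pi.single o η, Pi.single_nonneg.2 hη0.le, by simpa using hη0.ne', h⟩
  rw [energy_sub_single hp hφ] at hlt
  have hφo : 0 < |φ o| := by
    refine abs_pos.2 fun h0 => ?_
    rw [h0, abs_zero, Real.zero_rpow (by linarith), mul_zero, sub_zero] at hlt
    exact absurd (hcrit.1 φ hφ) (not_le.2 hlt)
  set c := v o / |φ o| with hc
  have hc0 : 0 < c := div_pos (hv o) hφo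
  have e : (fun x => v x * (c * |φ x| / v x)) = fun x => c * |φ x| := funext fun x =>
    mul_div_cancel₀ _ (hv x).ne'
  refine ⟨fun x => c * |φ x| / v x, fun x => div_nonneg (by positivity) (hv x).le,
    hφ.subset fun x hx hx0 => hx (by simp [hx0]), ?_, ?_⟩
  · have := (hv o).ne'
    simp only [hc]
    field_simp
  · rw [e, energy_const_mul hc0.le]
    have hcp : 0 < c ^ p := Real.rpow_pos_of_pos hc0 p
    calc c ^ p * energy p b m V (fun x => |φ x|) ≤ c ^ p * energy p b m V φ :=
          mul_le_mul_of_nonneg_left (energy_abs_le hp hb hφ) hcp.le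
      _ < c ^ p * (m o * η * |φ o| ^ p) := mul_lt_mul_of_pos_left (by linarith) hcp
      _ = (c * |φ o|) ^ p * (m o * η) := by
          rw [Real.mul_rpow hc0.le hφo.le]; ring
      _ = ε := by
          rw [hc, div_mul_cancel₀ _ hφo.ne', hη]; field_simp

end Energy

/-! ### Liouville comparison and minimal growth -/

section Liouville

variable {X : Type*} {p : ℝ} {b : X → X → ℝ} {m V : X → ℝ}

theorem mul_piconeGap_nonneg (hp : 1 < p) (hb : IsConnectedGraph b) {w ψ : X → ℝ}
    (hw0 : ∀ x, 0 ≤ w x) (hψ0 : ∀ x, 0 ≤ ψ x) (x y : X) :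
    0 ≤ b x y * piconeGap p (w x) (w y) (ψ x) (ψ y) :=
  mul_nonneg (hb.nonneg x y) (piconeGap_nonneg hp (hw0 x) (hw0 y) (hψ0 x) (hψ0 y))

theorem IsSuperharmonic.tsum_piconeGap_le (hp : 1 < p) (hb : IsConnectedGraph b)
    (hm : ∀ x, 0 < m x) {w ψ : X → ℝ} (hw : IsSuperharmonic p b m V w) (hw0 : ∀ x, 0 ≤ w x)
    (hψ0 : ∀ x, 0 ≤ ψ x) (hψ : ψ.support.Finite) :
    ∑' q : X × X, b q.1 q.2 * piconeGap p (w q.1) (w q.2) (ψ q.1) (ψ q.2) ≤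
      2 * energy p b m V (fun x => w x * ψ x) := by
  rw [energy_mul_eq hp hb hm hw.1 hψ0 hψ]
  have : 0 ≤ ∑' x, m x * (w x * ψ x ^ p) * schrodinger p b m V w x := tsum_nonneg fun x =>
    mul_nonneg (mul_nonneg (hm x).le (mul_nonneg (hw0 x) (Real.rpow_nonneg (hψ0 x) p))) (hw.2 x)
  linarith

theorem IsSuperharmonic.mul_piconeGap_le (hp : 1 < p) (hb : IsConnectedGraph b)
    (hm : ∀ x, 0 < m x) {w ψ : X → ℝ} (hw : IsSuperharmonic p b m V w) (hw0 : ∀ x, 0 ≤ w x)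
    (hψ0 : ∀ x, 0 ≤ ψ x) (hψ : ψ.support.Finite) (x y : X) :
    b x y * piconeGap p (w x) (w y) (ψ x) (ψ y) ≤ 2 * energy p b m V (fun x => w x * ψ x) :=
  ((summable_piconeGap hp hb hw.1 hψ).le_tsum (x, y) fun q _ =>
    mul_piconeGap_nonneg hp hb hw0 hψ0 q.1 q.2).trans (hw.tsum_piconeGap_le hp hb hm hw0 hψ0 hψ)

theorem IsSubharmonic.energy_le (hp : 1 < p) (hb : IsConnectedGraph b)
    (hm : ∀ x, 0 < m x) {w ψ : X → ℝ} (hw : IsSubharmonic p b m V w) (hw0 : ∀ x, 0 ≤ w x)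
    (hψ0 : ∀ x, 0 ≤ ψ x) (hψ : ψ.support.Finite) :
    2 * energy p b m V (fun x => w x * ψ x) ≤
      ∑' q : X × X, b q.1 q.2 * piconeGap p (w q.1) (w q.2) (ψ q.1) (ψ q.2) := by
  rw [energy_mul_eq hp hb hm hw.1 hψ0 hψ]
  have : ∑' x, m x * (w x * ψ x ^ p) * schrodinger p b m V w x ≤ 0 := tsum_nonpos fun x =>
    mul_nonpos_of_nonneg_of_nonpos
      (mul_nonneg (hm x).le (mul_nonneg (hw0 x) (Real.rpow_nonneg (hψ0 x) p))) (hw.2 x)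
  linarith

theorem tendsto_zero_of_mul_le {k K : ℝ} (hk : 0 < k) {f e : ℕ → ℝ} (hf : ∀ n, 0 ≤ f n)
    (hfe : ∀ n, k * f n ≤ K * e n) (he : Tendsto e atTop (nhds 0)) :
    Tendsto f atTop (nhds 0) := by
  refine squeeze_zero hf (fun n => ?_) (by simpa using he.const_mul (K / k))
  rw [div_mul_eq_mul_div, le_div_iff₀ hk, mul_comm]
  exact hfe n

theorem tendsto_piconeGap (hp : 1 < p) (a c : ℝ) {α β : ℕ → ℝ} {l l' : ℝ}
    (hα : Tendsto α atTop (nhds l)) (hβ : Tendsto β atTop (nhds l')) :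
    Tendsto (fun n => piconeGap p a c (α n) (β n)) atTop (nhds (piconeGap p a c l l')) := by
  have hp0 : 0 < p := by linarith
  unfold piconeGap
  exact (((hα.const_mul a).sub (hβ.const_mul c)).abs.rpow_const (.inr hp0.le)).sub
    ((((hα.rpow_const (.inr hp0.le)).const_mul a).sub
      ((hβ.rpow_const (.inr hp0.le)).const_mul c)).const_mul _)

/-- Liouville comparison principle: a nonnegative subharmonic function that is dominated by the
ground state of a critical operator is proportional to every positive superharmonic function. -/
theorem exists_eq_const_mul (hp : 1 < p) (hm : ∀ x, 0 < m x) (hb : IsConnectedGraph b)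
    {s : X → ℝ} (hs : IsSuperharmonic p b m V s) (hs0 : ∀ x, 0 < s x)
    {b' : X → X → ℝ} (hb' : IsConnectedGraph b') {V' v : X → ℝ}
    (hv : IsAgmonGroundState p b' m V' v)
    {u : X → ℝ} (hu : IsSubharmonic p b m V u) (hu0 : ∀ x, 0 ≤ u x) (hne : u ≠ 0)
    {C : ℝ} (hC : 0 < C)
    (h_weight : ∀ x y, 0 < u x → 0 < u y →
      b x y ^ (2 / p) * (u x * u y) ≤ C * (b' x y ^ (2 / p) * (v x * v y)))
    (h_grad : ∀ x y, 0 < u x → 0 < u y → 0 < b x y →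
      gradientWeight p b u x y ≤ ENNReal.ofReal C * gradientWeight p b' v x y) :
    ∃ c > 0, ∀ x, u x = c * s x := by
  obtain ⟨hcrit, hv0, hvs⟩ := hv
  obtain ⟨o, ho⟩ := Function.ne_iff.1 hne
  have ho : 0 < u o := (hu0 o).lt_of_ne' ho
  obtain ⟨K, hK, hcomp⟩ := exists_piconeGap_comparison hp hb.nonneg hb'.nonneg hu0 hv0 hC
    h_weight h_grad
  choose ψ hψ0 hψ hψo hψe using fun n : ℕ =>
    hcrit.exists_energy_lt hp hb' hm hv0 o (Nat.one_div_pos_of_nat (α := ℝ) (n := n))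
  have hlim : Tendsto (fun n : ℕ => 1 / ((n : ℝ) + 1)) atTop (nhds 0) :=
    tendsto_one_div_add_atTop_nhds_zero_nat
  -- Superharmonicity of `v` bounds each single gap by twice the energy of `v * ψ n`.
  have hedge' : ∀ x y, 0 < b' x y →
      Tendsto (fun n => piconeGap p (v x) (v y) (ψ n x) (ψ n y)) atTop (nhds 0) :=
    fun x y hxy => tendsto_zero_of_mul_le (K := 2) hxy
      (fun n => piconeGap_nonneg hp (hv0 x).le (hv0 y).le (hψ0 n x) (hψ0 n y))
      (fun n => (hvs.mul_piconeGap_le hp hb' hm (fun x => (hv0 x).le) (hψ0 n) (hψ n) x y).trans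
        (mul_le_mul_of_nonneg_left (hψe n).le two_pos.le)) hlim
  have hψlim : ∀ x, Tendsto (fun n => ψ n x) atTop (nhds 1) := fun x => by
    induction hb'.connected o x with
    | refl => simp [hψo]
    | tail _ hxy ih =>
      exact tendsto_of_piconeGap_tendsto_zero hp (hv0 _) (hv0 _) (fun n => hψ0 n _)
        (fun n => hψ0 n _) ih (hedge' _ _ hxy)
  have hφ0 : ∀ n x, 0 ≤ u x * ψ n x / s x := fun n x =>
    div_nonneg (mul_nonneg (hu0 x) (hψ0 n x)) (hs0 x).le
  -- Chain: gaps of `s`, energy of `u * ψ n`, gaps of `u`, gaps of `v`, energy of `v * ψ n`. The two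
  -- energies of `u * ψ n` match because `s * (u * ψ n / s) = u * ψ n`.
  have hbound : ∀ n x y,
      b x y * piconeGap p (s x) (s y) (u x * ψ n x / s x) (u y * ψ n y / s y) ≤
        2 * K * (1 / ((n : ℝ) + 1)) := fun n x y => by
    have h1 := hs.mul_piconeGap_le hp hb hm (fun x => (hs0 x).le) (hφ0 n)
      ((hψ n).subset fun x hx hx0 => hx (by simp [hx0])) x y
    have e : (fun x => s x * (u x * ψ n x / s x)) = fun x => u x * ψ n x := funext fun x =>
      mul_div_cancel₀ _ (hs0 x).ne'
    rw [e] at h1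
    have h2 := hu.energy_le hp hb hm hu0 (hψ0 n) (hψ n)
    have hc : ∀ q : X × X, b q.1 q.2 * piconeGap p (u q.1) (u q.2) (ψ n q.1) (ψ n q.2) ≤
        K * (b' q.1 q.2 * piconeGap p (v q.1) (v q.2) (ψ n q.1) (ψ n q.2)) :=
      fun q => hcomp (ψ n) (hψ0 n) q.1 q.2
    have h3 := (summable_piconeGap hp hb hu.1 (hψ n)).tsum_le_tsum hc
      ((summable_piconeGap hp hb' hvs.1 (hψ n)).mul_left K)
    rw [tsum_mul_left] at h3
    have h4 := hvs.tsum_piconeGap_le hp hb' hm (fun x => (hv0 x).le) (hψ0 n) (hψ n)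
    have h5 := mul_le_mul_of_nonneg_left
      (h4.trans (mul_le_mul_of_nonneg_left (hψe n).le two_pos.le)) hK.le
    linarith
  have hratio : ∀ x y, 0 < b x y → u x / s x = u y / s y := fun x y hxy => by
    have h0 := tendsto_zero_of_mul_le hxy
      (fun n => piconeGap_nonneg hp (hs0 x).le (hs0 y).le (hφ0 n x) (hφ0 n y))
      (fun n => hbound n x y) hlim
    have hx : ∀ x, Tendsto (fun n => u x * ψ n x / s x) atTop (nhds (u x / s x)) := fun x => by
      simpa using ((hψlim x).const_mul (u x)).div_const (s x)
    exact eq_of_piconeGap_eq_zero hp (hs0 x) (hs0 y) (div_nonneg (hu0 x) (hs0 x).le)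
      (div_nonneg (hu0 y) (hs0 y).le)
      (tendsto_nhds_unique (tendsto_piconeGap hp _ _ (hx x) (hx y)) h0)
  refine ⟨u o / s o, div_pos ho (hs0 o), fun x => ?_⟩
  have : u o / s o = u x / s x := by
    induction hb.connected o x with
    | refl => rfl
    | tail _ hxy ih => exact ih.trans (hratio _ _ hxy)
  rw [this, div_mul_cancel₀ _ (hs0 x).ne']

/-- A positive solution of minimal growth is bounded by a multiple of every strictly positive
superharmonic function. -/
theorem IsMinimalGrowth.exists_le_const_mul {g s : X → ℝ} (hp : 1 < p)
    (hg : IsMinimalGrowth p b m V g) (hs : IsSuperharmonic p b m V s) (hs0 : ∀ x, 0 < s x) :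
    ∃ K > 0, ∀ x, g x ≤ K * s x := by
  obtain ⟨-, hg0, K₀, -, hmin⟩ := hg
  -- The sum dominates each ratio `g / s` on `K₀`; the summand 1 keeps `K` positive even if `K₀` is
  -- empty.
  set K := 1 + ∑ x ∈ K₀, g x / s x with hK
  have hterm : ∀ x, 0 ≤ g x / s x := fun x => div_nonneg (hg0 x).le (hs0 x).le
  have hK1 : 0 < K := by
    have := Finset.sum_nonneg fun x (_ : x ∈ K₀) => hterm x
    linarith
  have hK₀ : ∀ x ∈ K₀, g x ≤ K * s x := fun x hx => by
    rw [← div_le_iff₀ (hs0 x)]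
    have := Finset.single_le_sum (fun x (_ : x ∈ K₀) => hterm x) hx
    linarith
  have hr : 0 < p - 1 := by linarith
  refine ⟨K, hK1, fun x => ?_⟩
  by_cases hx : x ∈ K₀
  · exact hK₀ x hx
  refine hmin K₀ subset_rfl (fun x => K * s x) (fun x => ?_) (fun x => mul_pos hK1 (hs0 x))
    (fun x _ => ?_) hK₀ x hx
  · refine ((hs.1 x).mul_left (K ^ (p - 1))).congr fun y => ?_
    rw [← mul_sub, abs_mul, abs_of_pos hK1, Real.mul_rpow hK1.le (abs_nonneg _)]
    ring
  · have e : schrodinger p b m V (fun x => K * s x) x = K ^ (p - 1) * schrodinger p b m V s x := by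
      simp only [schrodinger, pLaplacian, ← mul_sub, signedPow_mul hK1]
      simp only [mul_left_comm _ (K ^ (p - 1)), tsum_mul_left]
      ring
    rw [e]
    exact mul_nonneg (Real.rpow_nonneg hK1.le _) (hs.2 x)

end Liouville

end QuasiLandis

end

/-! ### The corollary -/

theorem mainTheorem5 {X : Type*} [Infinite X] [Countable X]
    (p : ℝ) (hp : 1 < p)
    (m : X → ℝ) (hm : ∀ x, 0 < m x)
    (b : X → X → ℝ) (hb : QuasiLandis.IsConnectedGraph b)
    (V : X → ℝ) (hV : ∀ x, V x ≤ 0)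
    (hH : QuasiLandis.IsPositiveOperator p b m V)
    (b' : X → X → ℝ) (hb' : QuasiLandis.IsConnectedGraph b')
    (V' : X → ℝ) (v : X → ℝ)
    (hv : QuasiLandis.IsAgmonGroundState p b' m V' v)
    (u : X → ℝ) (hu : QuasiLandis.IsSubharmonic p b m V u) (hu_pos : u⁺ ≠ 0)
    (C : ℝ) (hC : 0 < C)
    (h_weight : ∀ x y, 0 < u x → 0 < u y →
      b x y ^ (2 / p) * (u⁺ x * u⁺ y) ≤ C * (b' x y ^ (2 / p) * (v x * v y)))
    (h_grad : ∀ x y, 0 < u x → 0 < u y → 0 < b x y →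
      QuasiLandis.gradientWeight p b u⁺ x y
        ≤ ENNReal.ofReal C * QuasiLandis.gradientWeight p b' v x y)
    (g : X → ℝ) (hg : QuasiLandis.IsMinimalGrowth p b m 0 g)
    (h_liminf : liminf (fun x => ENNReal.ofReal (u⁺ x / g x)) cofinite = 0) :
    u = 0 := by
  exfalso
  obtain ⟨s, hs_nonneg, hs_ne, hs⟩ := hH
  have hs0 := hs.pos hp hb hm hs_nonneg hs_ne
  have hpos : ∀ x, 0 < u⁺ x → 0 < u x := fun x hx => by
    simpa [Pi.posPart_apply] using hx
  obtain ⟨c, hc, hcs⟩ := QuasiLandis.exists_eq_const_mul hp hm hb hs hs0 hb' hv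
    (hu.posPart hp hb hm) (fun x => posPart_nonneg (u x)) hu_pos hC
    (fun x y hx hy => h_weight x y (hpos x hx) (hpos y hy))
    (fun x y hx hy => h_grad x y (hpos x hx) (hpos y hy))
  -- Dropping the nonpositive potential term from `H[s] ≥ 0` leaves `Δ_p s ≥ 0`.
  have hs' : QuasiLandis.IsSuperharmonic p b m 0 s := ⟨hs.1, fun x => by
    have h := hs.2 x
    have h2 : V x * QuasiLandis.signedPow (s x) (p - 1) ≤ 0 :=
      mul_nonpos_of_nonpos_of_nonneg (hV x) (by
        rw [QuasiLandis.signedPow_of_nonneg (hs0 x).le (by linarith)]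
        exact Real.rpow_nonneg (hs0 x).le _)
    simp only [QuasiLandis.schrodinger, Pi.zero_apply, zero_mul, add_zero] at h ⊢
    linarith⟩
  obtain ⟨K, hK, hgK⟩ := hg.exists_le_const_mul hp hs' hs0
  have hge : ENNReal.ofReal (c / K) ≤ liminf (fun x => ENNReal.ofReal (u⁺ x / g x)) cofinite := by
    refine le_liminf_of_le (by isBoundedDefault) (Eventually.of_forall fun x => ?_)
    refine ENNReal.ofReal_le_ofReal ?_
    rw [hcs x, div_le_div_iff₀ hK (hg.2.1 x)]
    calc c * g x ≤ c * (K * s x) := mul_le_mul_of_nonneg_left (hgK x) hc.le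
      _ = c * s x * K := by ring
  rw [h_liminf] at hge
  exact (ENNReal.ofReal_pos.2 (div_pos hc hK)).not_ge hge
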